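/- Let $(B_t)_{t\ge 0}$ be a $d$-dimensional standard Brownian motion on a complete probability space $(\Omega,\mathcal F,P)$, let $(\mathcal F_t)$ be its natural filtration augmented by the $P$-null sets, and let $T>0$, $\mu>0$. Let $g:[0,T]\times\mathbf R^n\times\mathbf R^{n\times d}\to\mathbf R^n$ be Borel measurable (a deterministic generator) such that $\int_0^T|g(s,y,z)|\,ds<\infty$ for all $(y,z)$ and, for a.e. $s\in[0,T]$, $|g(s,y_1,z)-g(s,y_2,z)|\le\mu|y_1-y_2|$ for all $y_1,y_2,z$. No condition is imposed on the dependence of $g$ on $z$ beyond measurability. For $(t,y)\in[0,T)\times\mathbf R^n$, $\varepsilon\in[0,T-t]$ and a Borel function $h:[0,t+\varepsilon]\to\mathbf R^{n\times d}$ with $\int_0^{t+\varepsilon}|h(s)|^2ds<\infty$, consider the mean-field BSDE $$Y_s=y+\int_0^{t+\varepsilon}h(r)\,dB_r+\int_s^{t+\varepsilon}g(r,E[Y_r],Z_r)\,dr-\int_s^{t+\varepsilon}Z_r\,dB_r,\qquad s\in[0,t+\varepsilon].\tag{1}$$ A solution of (1) is a pair $(Y,Z)$ of predictable processes on $[0,t+\varepsilon]$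 with $Y$ continuous and $\mathbf R^n$-valued, $Y_s$ integrable for every $s$, $Z$ $\mathbf R^{n\times d}$-valued, $\int_0^{t+\varepsilon}|Z_s|^2ds<\infty$ and $\int_0^{t+\varepsilon}|g(s,E[Y_s],Z_s)|\,ds<\infty$ a.s., such that (1) holds a.s. (i) Explicit solution. If moreover $\int_0^{t+\varepsilon}|g(s,0,h(s))|^2ds<\infty$, then the backward ODE $$\varphi(s)=y+\int_s^{t+\varepsilon}g(r,\varphi(r),h(r))\,dr,\qquad s\in[0,t+\varepsilon],\tag{2}$$ has a solution $\varphi\in L^2([0,t+\varepsilon];\mathbf R^n)$, the Itô integral process $\int_0^\cdot h\,dB$ exists as a continuous predictable process, and, for every such $\varphi$ and every version of this integral process, $$Y_s=\varphi(s)+\int_0^s h(r)\,dB_r,\qquad Z_s=h(s),\qquad s\in[0,t+\varepsilon],\tag{3}$$ is a solution of (1). For $h=z\,1_{[t,t+\varepsilon]}$ with $z\in\mathbf R^{n\times d}$ all of this holds without the additional square integrability condition on $g(\cdot,0,h(\cdot))$. (ii) Invariant representation. Let $(y,z)\in\mathbf R^n\times\mathbf R^{n\times d}$. For a.e. $t\in[0,T)$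 the following holds. For each $\varepsilon\in(0,T-t]$ let $Y^{t+\varepsilon}$ be given by (3) with $h=z\,1_{[t,t+\varepsilon]}$. Then each $Y^{t+\varepsilon}_t$ is almost surely equal to a deterministic vector, and, with these vectors in place of $Y^{t+\varepsilon}_t$, $$g(t,y,z)=\lim_{\varepsilon\to0^+}\frac1\varepsilon\bigl(Y^{t+\varepsilon}_t-y\bigr).$$ -/

import Mathlib

open MeasureTheory ProbabilityTheory Filter Topology
open scoped NNReal ENNReal

namespace MeanFieldBSDE

/-- `ℝⁿ` with the Euclidean norm. -/
abbrev Vec (n : ℕ) : Type := EuclideanSpace ℝ (Fin n)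

/-- `ℝ^{n×d}` with the Euclidean (Frobenius) norm; the entry of `A` in row `i` and column `j`
is `A (i, j)`. -/
abbrev Mat (n d : ℕ) : Type := EuclideanSpace ℝ (Fin n × Fin d)

/-- The product of an `n × d` matrix with a vector of `ℝᵈ`. -/
noncomputable def mulVec {n d : ℕ} (A : Mat n d) (v : Vec d) : Vec n :=
  WithLp.toLp 2 (fun i => ∑ j, A (i, j) * v j)

/-- `B` is a `d`-dimensional standard Brownian motion under `P`: its components are independent
one-dimensional standard Brownian motions. -/
structure IsBrownianMotion {Ω : Type*} [MeasurableSpace Ω] {d : ℕ}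
    (B : ℝ≥0 → Ω → Vec d) (P : Measure Ω) : Prop where
  measurable : ∀ t, Measurable (B t)
  component : ∀ j, IsBrownianReal (fun t ω => B t ω j) P
  indep : iIndepFun (fun (j : Fin d) (ω : Ω) (t : ℝ≥0) => B t ω j) P

/-- The natural filtration of the Brownian motion `B`, augmented by the `P`-null sets. -/
def augmentedFiltration {Ω : Type*} [mΩ : MeasurableSpace Ω] {d : ℕ}
    {B : ℝ≥0 → Ω → Vec d} {P : Measure Ω} [P.IsComplete] (hB : IsBrownianMotion B P) :
    Filtration ℝ≥0 mΩ where
  seq t := (⨆ s ≤ t, MeasurableSpace.comap (B s) inferInstance) ⊔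
    MeasurableSpace.generateFrom {N : Set Ω | P N = 0}
  mono' s t hst := by
    refine sup_le_sup_right ?_ _
    exact biSup_mono fun r hr => le_trans hr hst
  le' t := by
    refine sup_le (iSup₂_le fun s _ => (hB.measurable s).comap_le) ?_
    exact MeasurableSpace.generateFrom_le fun N hN => measurableSet_of_null hN

section Processes

variable {Ω : Type*} [mΩ : MeasurableSpace Ω]

/-- The restriction to the time interval `[0, τ]` of the process `X` is predictable. -/
def IsPredictableUpTo {E : Type*} [TopologicalSpace E] [Zero E] (F : Filtration ℝ≥0 mΩ)
    (τ : ℝ≥0) (X : ℝ≥0 → Ω → E) : Prop :=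
  IsStronglyPredictable F ((Set.Iic τ).indicator X)

/-- The space of continuous predictable `ℝⁿ`-valued processes on `[0, τ]`. -/
structure MemS {n : ℕ} (P : Measure Ω) (F : Filtration ℝ≥0 mΩ) (τ : ℝ≥0)
    (Y : ℝ≥0 → Ω → Vec n) : Prop where
  predictable : IsPredictableUpTo F τ Y
  continuous : ∀ᵐ ω ∂P, ContinuousOn (fun s => Y s ω) (Set.Iic τ)

/-- The space of predictable `ℝ^{n×d}`-valued processes on `[0, τ]` with
`∫_0^τ |Z_s|² ds < ∞` almost surely. -/
structure MemH2 {n d : ℕ} (P : Measure Ω) (F : Filtration ℝ≥0 mΩ) (τ : ℝ≥0)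
    (Z : ℝ≥0 → Ω → Mat n d) : Prop where
  predictable : IsPredictableUpTo F τ Z
  sq_integrable : ∀ᵐ ω ∂P, ∫⁻ s in Set.Icc (0 : ℝ) τ, ‖Z s.toNNReal ω‖ₑ ^ 2 < ∞

/-- The simple predictable process `∑_{i < steps} 1_{(tᵢ, tᵢ₊₁]} ξᵢ`, where
`t₀ ≤ t₁ ≤ …` and each `ξᵢ` is bounded and measurable at time `tᵢ`. -/
structure SimpleProcess (n d : ℕ) (F : Filtration ℝ≥0 mΩ) where
  steps : ℕ
  time : ℕ → ℝ≥0
  time_mono : Monotone time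
  value : ℕ → Ω → Mat n d
  measurable_value : ∀ i, StronglyMeasurable[F (time i)] (value i)
  bounded_value : ∀ i, ∃ C : ℝ, ∀ ω, ‖value i ω‖ ≤ C

/-- The value at time `s` of a simple process. -/
noncomputable def SimpleProcess.eval {n d : ℕ} {F : Filtration ℝ≥0 mΩ}
    (S : SimpleProcess n d F) (s : ℝ≥0) (ω : Ω) : Mat n d :=
  ∑ i ∈ Finset.range S.steps,
    (Set.Ioc (S.time i) (S.time (i + 1))).indicator (fun _ => S.value i ω) s

/-- The stochastic integral `∫_0^s S dB = ∑ᵢ ξᵢ (B_{tᵢ₊₁ ∧ s} - B_{tᵢ ∧ s})` of a simple process. -/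
noncomputable def SimpleProcess.integral {n d : ℕ} {F : Filtration ℝ≥0 mΩ}
    (S : SimpleProcess n d F) (B : ℝ≥0 → Ω → Vec d) (s : ℝ≥0) (ω : Ω) : Vec n :=
  ∑ i ∈ Finset.range S.steps,
    mulVec (S.value i ω) (B (min (S.time (i + 1)) s) ω - B (min (S.time i) s) ω)

/-- The process `M` is (a version of) the Itô integral process `s ↦ ∫_0^s Z_r dB_r` on `[0, τ]`,
for `Z` predictable and almost surely square integrable on `[0, τ]`: `M` is a continuous
predictable process, and there are simple processes `S k` such that
`∫_0^τ |S k - Z|² dr → 0` in probability and `∫_0^s S k dB → M_s` in probability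
for every `s ∈ [0, τ]`. -/
structure IsItoIntegral {n d : ℕ} (P : Measure Ω) (F : Filtration ℝ≥0 mΩ)
    (B : ℝ≥0 → Ω → Vec d) (τ : ℝ≥0) (Z : ℝ≥0 → Ω → Mat n d) (M : ℝ≥0 → Ω → Vec n) : Prop where
  integrand_mem : MemH2 P F τ Z
  integral_mem : MemS P F τ M
  approx : ∃ S : ℕ → SimpleProcess n d F,
    (∀ δ : ℝ≥0∞, 0 < δ → Tendsto (fun k => P {ω | δ ≤
      ∫⁻ s in Set.Icc (0 : ℝ) τ, ‖(S k).eval s.toNNReal ω - Z s.toNNReal ω‖ₑ ^ 2}) atTop (𝓝 0)) ∧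
    ∀ s ≤ τ, TendstoInMeasure P (fun k => (S k).integral B s) atTop (M s)

end Processes

/-- The deterministic functions on `[0, τ]` that are Borel measurable and square integrable.
(A deterministic process is predictable if and only if it is a Borel function of time.) -/
structure MemDetL2 {E : Type*} [NormedAddCommGroup E] [MeasurableSpace E] (τ : ℝ≥0)
    (f : ℝ → E) : Prop where
  measurable : Measurable (fun s : Set.Icc (0 : ℝ) τ => f s)
  sq_integrable : ∫⁻ s in Set.Icc (0 : ℝ) τ, ‖f s‖ₑ ^ 2 < ∞

/-- Deterministic generators on `[0, T]` that are Lipschitz in `y` with constant `μ`, with no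
condition on the dependence on `z` besides measurability. -/
structure IsDetGenerator {n d : ℕ} (T : ℝ≥0) (μ : ℝ) (g : ℝ → Vec n → Mat n d → Vec n) :
    Prop where
  measurable : Measurable (fun p : Set.Icc (0 : ℝ) T × Vec n × Mat n d => g p.1 p.2.1 p.2.2)
  integrable : ∀ y z, IntegrableOn (fun t => g t y z) (Set.Icc 0 T)
  lipschitz : ∀ᵐ t ∂(volume.restrict (Set.Icc (0 : ℝ) T)), ∀ y₁ y₂ z,
    ‖g t y₁ z - g t y₂ z‖ ≤ μ * ‖y₁ - y₂‖

/-- `φ` is a square integrable solution of the backward ODE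
`φ(s) = y + ∫_s^τ g(r, φ(r), h(r)) dr`, `s ∈ [0, τ]`. -/
structure IsBackwardODESolution {n d : ℕ} (g : ℝ → Vec n → Mat n d → Vec n) (y : Vec n)
    (h : ℝ → Mat n d) (τ : ℝ≥0) (φ : ℝ → Vec n) : Prop where
  mem : MemDetL2 τ φ
  integrable : IntervalIntegrable (fun r => g r (φ r) (h r)) volume 0 τ
  eqn : ∀ s ∈ Set.Icc (0 : ℝ) τ, φ s = y + ∫ r in s..τ, g r (φ r) (h r)

/-- `(Y, Z)` is an adapted solution on `[0, τ]` of the mean-field BSDE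
`Y_s = y + ∫_0^τ h dB + ∫_s^τ g(r, E[Y_r], Z_r) dr - ∫_s^τ Z_r dB_r`.
Here `H` and `N` are the Itô integral processes of `h` and of `Z`, which are unique up to
indistinguishability. -/
structure IsMeanFieldBSDESolution {Ω : Type*} [mΩ : MeasurableSpace Ω] {n d : ℕ}
    (P : Measure Ω) (F : Filtration ℝ≥0 mΩ) (B : ℝ≥0 → Ω → Vec d)
    (g : ℝ → Vec n → Mat n d → Vec n) (y : Vec n) (h : ℝ → Mat n d) (τ : ℝ≥0)
    (Y : ℝ≥0 → Ω → Vec n) (Z : ℝ≥0 → Ω → Mat n d) : Prop where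
  memY : MemS P F τ Y
  memZ : MemH2 P F τ Z
  integrableY : ∀ s ≤ τ, Integrable (Y s) P
  integrable : ∀ᵐ ω ∂P,
    IntervalIntegrable (fun r => g r (P[Y r.toNNReal]) (Z r.toNNReal ω)) volume 0 τ
  eqn : ∃ H N : ℝ≥0 → Ω → Vec n,
    IsItoIntegral P F B τ (fun s _ => h s) H ∧ IsItoIntegral P F B τ Z N ∧
    ∀ᵐ ω ∂P, ∀ s ≤ τ, Y s ω = y + H τ ω
      + (∫ r in (s : ℝ)..τ, g r (P[Y r.toNNReal]) (Z r.toNNReal ω)) - (N τ ω - N s ω)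

/-- The function `z · 1_{[t, t+ε]}`. -/
noncomputable def constOn {n d : ℕ} (t ε : ℝ≥0) (z : Mat n d) : ℝ → Mat n d :=
  (Set.Icc (t : ℝ) (t + ε)).indicator (fun _ => z)

end MeanFieldBSDE

open MeanFieldBSDE

/-!
For a deterministic integrand `h`, the Itô integral `M = ∫ h dB` is centred, so that the process
`Y = φ + M` has mean `φ`. With `Z = h`, the mean-field BSDE for `Y` then reduces to the backward
ODE for `φ`, the stochastic integrals on both sides being the same. Three facts are needed.

* Every version of `∫ h dB` is integrable and centred
  (`IsItoIntegral.memLp_and_integral_eq_zero`). The approximating simple processes of a version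
  converge only in probability, but they may be stopped just before their energy exceeds
  `2 ∫ |h|² + 2` (`SimpleProcess.truncate`); this alters them on events of vanishing probability,
  and the stopped integrals are centred and bounded in `L²`. The same truncation shows that the
  integral vanishes as long as the integrand does (`IsItoIntegral.ae_eq_zero`).
* A version exists (`exists_isItoIntegral`): `h` is a fast `L²`-limit of deterministic step
  functions, whose integrals are continuous martingales, and these converge uniformly almost surely
  by Doob's maximal inequality (`measure_exists_lt_abs_le`) and the Borel–Cantelli lemma. This fact
  and the previous one rest on the independence of the increments of each component of `B` from the
  past of the whole of `B` (`IsBrownianMotion.isFilteredBrownian`).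
* The backward ODE has a solution, because an iterate of its Picard operator is a contraction
  (`IsLipschitzRHS.exists_solution`). This needs `g(·, 0, h(·))` to be integrable, which for
  `h = z 1_{[t, t + ε]}` follows from the integrability of `g(·, 0, z)` and `g(·, 0, 0)`.

For `h = z 1_{[t, t + ε]}` the Itô integral vanishes at time `t`, so `Y_t` is the constant `φ(t)`,
where `φ(t) - y = ∫_t^{t+ε} g(r, φ(r), z) dr`. If `μ ε ≤ 1 / 2`, the maximal deviation of `φ` from
`y` on `[t, t + ε]` is at most `2 ∫_t^{t+ε} |g(r, y, z)| dr`, which tends to zero. By the Lipschitz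
condition, `φ(r)` may therefore be replaced by `y` at the cost of an error `o(ε)`
(`IsBackwardODESolution.norm_sub_integral_le`), and the limit is identified by Lebesgue's
differentiation theorem.
-/

namespace MeanFieldBSDE

/-! ### Brownian motion relative to the augmented filtration -/

/-- `W` is a one-dimensional Brownian motion relative to the filtration `F`, up to the continuity
of the paths: it is adapted, and its increments after time `s` are centred, have the right
variance and are independent of `F s`. -/
structure IsFilteredBrownian {Ω : Type*} [mΩ : MeasurableSpace Ω] (W : ℝ≥0 → Ω → ℝ)
    (F : Filtration ℝ≥0 mΩ) (P : Measure Ω) : Prop where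
  adapted : ∀ t, StronglyMeasurable[F t] (W t)
  memLp : ∀ t, MemLp (W t) 2 P
  indep : ∀ s t, s ≤ t → Indep (MeasurableSpace.comap (W t - W s) inferInstance) (F s) P
  mean : ∀ t, ∫ ω, W t ω ∂P = 0
  mean_sq : ∀ s t, s ≤ t → ∫ ω, (W t ω - W s ω) ^ 2 ∂P = t - s

section Independence

variable {Ω : Type*} [mΩ : MeasurableSpace Ω] {P : Measure Ω}

/-- If `X` is independent of `O`, and two functions of `X` are independent, then the first one is
independent of the pair formed by the second one and `O`. -/
lemma indepFun_comp_prodMk [IsProbabilityMeasure P] {α β γ δ : Type*} [MeasurableSpace α]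
    [MeasurableSpace β] [MeasurableSpace γ] [MeasurableSpace δ] {X : Ω → α} {O : Ω → β}
    {f : α → γ} {g : α → δ} (hX : Measurable X) (hO : Measurable O) (hf : Measurable f)
    (hg : Measurable g) (hXO : IndepFun X O P)
    (hfg : IndepFun (fun ω => f (X ω)) (fun ω => g (X ω)) P) :
    IndepFun (fun ω => f (X ω)) (fun ω => (g (X ω), O ω)) P := by
  have hfX : Measurable fun ω => f (X ω) := hf.comp hX
  have hgX : Measurable fun ω => g (X ω) := hg.comp hX
  have := Measure.isProbabilityMeasure_map (μ := P) hX.aemeasurable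
  have := Measure.isProbabilityMeasure_map (μ := P) hO.aemeasurable
  have := Measure.isProbabilityMeasure_map (μ := P) hfX.aemeasurable
  have := Measure.isProbabilityMeasure_map (μ := P) hgX.aemeasurable
  have h1 : IndepFun (fun ω => (f (X ω), g (X ω))) O P :=
    hXO.comp (φ := fun x => (f x, g x)) (ψ := id) (by fun_prop) measurable_id
  have h2 : IndepFun (fun ω => g (X ω)) O P := hXO.comp hg measurable_id
  rw [indepFun_iff_map_prod_eq_prod_map_map (by fun_prop) (by fun_prop)] at h1 h2 hfg ⊢
  rw [h2, ← Measure.prodAssoc_prod, ← hfg, ← h1, Measure.map_map (by fun_prop) (by fun_prop)]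
  rfl

/-- Adding null sets to a σ-algebra does not affect independence. -/
lemma indep_sup_generateFrom_null {m₁ m₂ : MeasurableSpace Ω} (h : Indep m₁ m₂ P) :
    Indep m₁ (m₂ ⊔ MeasurableSpace.generateFrom {N : Set Ω | P N = 0}) P := by
  have hle : m₂ ⊔ MeasurableSpace.generateFrom {N : Set Ω | P N = 0} ≤
      eventuallyMeasurableSpace m₂ (ae P) := by
    refine sup_le le_eventuallyMeasurableSpace (MeasurableSpace.generateFrom_le fun N hN => ?_)
    exact ⟨∅, MeasurableSet.empty, ae_eq_empty.2 hN⟩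
  rw [Indep_iff] at h ⊢
  intro t₁ t₂ h₁ h₂
  obtain ⟨t, ht, hts⟩ := hle _ h₂
  rw [measure_congr hts, measure_congr ((ae_eq_refl t₁).inter hts)]
  exact h t₁ t h₁ ht

lemma IsBrownianMotion.measurable_augmentedFiltration [P.IsComplete] {d : ℕ}
    {B : ℝ≥0 → Ω → Vec d} (hB : IsBrownianMotion B P) (t : ℝ≥0) :
    Measurable[augmentedFiltration hB t] (B t) := by
  rw [measurable_iff_comap_le]
  exact le_sup_of_le_left (le_iSup₂_of_le t le_rfl le_rfl)

variable [IsProbabilityMeasure P] [P.IsComplete] {d : ℕ} {B : ℝ≥0 → Ω → Vec d}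

/-- The increments of a component of `B` after time `s` are independent of the whole of `B`, with
all its components, up to time `s`. -/
lemma IsBrownianMotion.indep_increment (hB : IsBrownianMotion B P) (j : Fin d) {s t : ℝ≥0}
    (hst : s ≤ t) :
    Indep (MeasurableSpace.comap ((fun ω => B t ω j) - fun ω => B s ω j) inferInstance)
      (augmentedFiltration hB s) P := by
  have hBm : ∀ i, Measurable fun (ω : Ω) (t : ℝ≥0) => B t ω i := fun i =>
    measurable_pi_lambda _ fun t =>
      (EuclideanSpace.proj (𝕜 := ℝ) i).continuous.measurable.comp (hB.measurable t)
  set O : Ω → ({j}ᶜ : Finset (Fin d)) → ℝ≥0 → ℝ := fun ω i t => B t ω i with hOdef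
  have hO : Measurable O := measurable_pi_lambda _ fun i => hBm i
  have hXO : IndepFun (fun ω t => B t ω j) O P := by
    have := hB.indep.indepFun_finset {j} {j}ᶜ disjoint_compl_right hBm
    exact this.comp (φ := fun x : ({j} : Finset (Fin d)) → ℝ≥0 → ℝ => x ⟨j, by simp⟩) (ψ := id)
      (by fun_prop) measurable_id
  have key := indepFun_comp_prodMk (P := P) (X := fun ω t => B t ω j) (O := O)
    (f := fun x u => x (s + u) - x s) (g := fun x (r : Set.Iic s) => x r) (hBm j) hO
    (by fun_prop) (by fun_prop) hXO ((hB.component j).indepFun_shift s)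
  have hev : Measurable fun x : ℝ≥0 → ℝ => x (t - s) := measurable_pi_apply _
  have key' := key.comp hev measurable_id
  rw [IndepFun_iff_Indep] at key'
  refine indep_sup_generateFrom_null (indep_of_indep_of_le_right
    (indep_of_indep_of_le_left key' ?_) ?_)
  · refine le_of_eq ?_
    congr 1
    ext ω
    simp [add_tsub_cancel_of_le hst]
  · refine iSup₂_le fun r hr => ?_
    rw [← measurable_iff_comap_le]
    have hcomp : ∀ i, Measurable[MeasurableSpace.comap
        (id ∘ fun ω => ((fun (r : Set.Iic s) => B r ω j), O ω)) inferInstance]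
        fun ω => B r ω i := by
      intro i
      rw [measurable_iff_comap_le]
      rintro _ ⟨u, hu, rfl⟩
      by_cases hi : i ∈ ({j}ᶜ : Finset (Fin d))
      · exact ⟨(fun x => x.2 ⟨i, hi⟩ r) ⁻¹' u, (by fun_prop : Measurable fun
          x : (Set.Iic s → ℝ) × (({j}ᶜ : Finset (Fin d)) → ℝ≥0 → ℝ) => x.2 ⟨i, hi⟩ r) hu, rfl⟩
      · obtain rfl : i = j := by simpa using hi
        exact ⟨(fun x => x.1 ⟨r, hr⟩) ⁻¹' u, (by fun_prop : Measurable fun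
          x : (Set.Iic s → ℝ) × (({i}ᶜ : Finset (Fin d)) → ℝ≥0 → ℝ) => x.1 ⟨r, hr⟩) hu, rfl⟩
    have hlp : Measurable (WithLp.toLp 2 : (Fin d → ℝ) → Vec d) :=
      (PiLp.continuous_toLp 2 _).measurable
    exact hlp.comp (@measurable_pi_lambda _ _ _ (_) _ _ hcomp)

/-- The components of `B` are Brownian motions relative to the augmented natural filtration
of `B`. -/
lemma IsBrownianMotion.isFilteredBrownian (hB : IsBrownianMotion B P) (j : Fin d) :
    IsFilteredBrownian (fun t ω => B t ω j) (augmentedFiltration hB) P where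
  adapted t := by
    have h : Measurable[augmentedFiltration hB t] fun ω => B t ω j :=
      (EuclideanSpace.proj (𝕜 := ℝ) j).continuous.measurable.comp
        (hB.measurable_augmentedFiltration t)
    exact h.stronglyMeasurable
  memLp t := by
    have h := (hB.component j).hasLaw_eval t
    have h2 : MemLp id 2 (P.map fun ω => B t ω j) := by
      rw [h.map_eq]
      exact memLp_id_gaussianReal 2
    exact (memLp_map_measure_iff aestronglyMeasurable_id h.aemeasurable).1 h2
  indep s t hst := hB.indep_increment j hst
  mean t := (hB.component j).integral_eval t
  mean_sq s t hst := by
    have h := (hB.component j).hasLaw_sub t s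
    have h0 : ∫ ω, (B t ω j - B s ω j) ∂P = 0 := by
      have := h.integral_eq
      simpa using this
    have hv := h.variance_eq
    rw [variance_id_gaussianReal, variance_of_integral_eq_zero] at hv
    · simp only [Pi.sub_apply] at hv
      rw [hv, coe_nndist, NNReal.val_eq_coe, NNReal.val_eq_coe, Real.dist_eq, abs_of_nonneg]
      exact sub_nonneg.2 (by exact_mod_cast hst)
    · exact h.aemeasurable
    · simpa using h0

end Independence

/-! ### Second moments of elementary stochastic integrals -/

/-- The length of `(a, b] ∩ (c, d]`. -/
lemma half_abs_sub_eq_length {a b c d : ℝ} (hab : a ≤ b) (hcd : c ≤ d) :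
    (|d - a| + |b - c| - (|d - b| + |a - c|)) / 2 = max (min b d - max a c) 0 := by
  rcases le_total a d with h1 | h1 <;> rcases le_total c b with h2 | h2 <;>
  rcases le_total b d with h3 | h3 <;> rcases le_total a c with h4 | h4 <;>
  simp only [hab, hcd, h1, h2, h3, h4, abs_of_nonneg, abs_of_nonpos, sub_nonneg, sub_nonpos,
    min_eq_left, min_eq_right, max_eq_left, max_eq_right] <;> linarith

namespace IsFilteredBrownian

variable {Ω : Type*} [mΩ : MeasurableSpace Ω] {P : Measure Ω}
  {F : Filtration ℝ≥0 mΩ} {W : ℝ≥0 → Ω → ℝ}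

/-- The covariance of two increments is the inner product in `L²(ℝ)` of the indicators of their
intervals. By polarization it is determined by the variances of the increments. -/
lemma integral_increment_mul_increment (hW : IsFilteredBrownian W F P) {a b c d : ℝ≥0}
    (hab : a ≤ b) (hcd : c ≤ d) :
    ∫ ω, (W b ω - W a ω) * (W d ω - W c ω) ∂P =
      ∫ r, (Set.Ioc (a : ℝ) b).indicator 1 r * (Set.Ioc (c : ℝ) d).indicator 1 r := by
  have hsq : ∀ s t : ℝ≥0, ∫ ω, (W t ω - W s ω) ^ 2 ∂P = |(t : ℝ) - s| := by
    intro s t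
    rcases le_total s t with h | h
    · rw [hW.mean_sq s t h, abs_of_nonneg (sub_nonneg.2 (by exact_mod_cast h))]
    · rw [abs_sub_comm, abs_of_nonneg (sub_nonneg.2 (by exact_mod_cast h)), ← hW.mean_sq t s h]
      congr 1; ext ω; ring
  have hi : ∀ s t : ℝ≥0, Integrable (fun ω => (W t ω - W s ω) ^ 2) P := fun s t =>
    ((hW.memLp t).sub (hW.memLp s)).integrable_sq
  have hi2 : ∀ s t s' t' : ℝ≥0,
      Integrable (fun ω => (W t ω - W s ω) ^ 2 + (W t' ω - W s' ω) ^ 2) P := fun s t s' t' =>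
    (hi s t).add (hi s' t')
  have hpol : ∫ ω, (W b ω - W a ω) * (W d ω - W c ω) ∂P =
      (|(d : ℝ) - a| + |(b : ℝ) - c| - (|(d : ℝ) - b| + |(a : ℝ) - c|)) / 2 := by
    rw [← hsq, ← hsq, ← hsq, ← hsq, ← integral_add (hi _ _) (hi _ _),
      ← integral_add (hi _ _) (hi _ _), ← integral_sub (hi2 _ _ _ _) (hi2 _ _ _ _), ← integral_div]
    congr 1; ext ω; ring
  have hind : ∀ r : ℝ, (Set.Ioc (a : ℝ) b).indicator (1 : ℝ → ℝ) r *
      (Set.Ioc (c : ℝ) d).indicator 1 r =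
      (Set.Ioc (max (a : ℝ) c) (min b d)).indicator 1 r := by
    intro r
    rw [← Set.Ioc_inter_Ioc, Set.inter_indicator_one, Pi.mul_apply]
  simp only [hind]
  rw [integral_indicator_one measurableSet_Ioc, hpol, measureReal_def, Real.volume_Ioc,
    ENNReal.toReal_ofReal']
  have hab' : (a : ℝ) ≤ b := by exact_mod_cast hab
  have hcd' : (c : ℝ) ≤ d := by exact_mod_cast hcd
  exact half_abs_sub_eq_length hab' hcd'

/-- The Itô isometry for deterministic linear combinations of arbitrary increments; the intervals
may overlap. -/
lemma integral_sq_sum_deterministic (hW : IsFilteredBrownian W F P) {ι : Type*} (I : Finset ι)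
    (c : ι → ℝ) {a b : ι → ℝ≥0} (hab : ∀ i, a i ≤ b i) :
    ∫ ω, (∑ i ∈ I, c i * (W (b i) ω - W (a i) ω)) ^ 2 ∂P =
      ∫ r, (∑ i ∈ I, c i * (Set.Ioc (a i : ℝ) (b i)).indicator 1 r) ^ 2 := by
  have hleft : ∀ i j, Integrable (fun ω => c i * (W (b i) ω - W (a i) ω) *
      (c j * (W (b j) ω - W (a j) ω))) P := fun i j =>
    (((hW.memLp _).sub (hW.memLp _)).const_mul (c i)).integrable_mul
      (((hW.memLp _).sub (hW.memLp _)).const_mul (c j))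
  have hind : ∀ i, MemLp ((Set.Ioc (a i : ℝ) (b i)).indicator (1 : ℝ → ℝ)) 2 volume := fun i =>
    memLp_indicator_const 2 measurableSet_Ioc 1 (Or.inr measure_Ioc_lt_top.ne)
  have hright : ∀ i j, Integrable (fun r => c i * (Set.Ioc (a i : ℝ) (b i)).indicator 1 r *
      (c j * (Set.Ioc (a j : ℝ) (b j)).indicator (1 : ℝ → ℝ) r)) := fun i j =>
    ((hind i).const_mul (c i)).integrable_mul ((hind j).const_mul (c j))
  simp only [sq, Finset.sum_mul_sum]
  rw [integral_finsetSum _ fun i _ => integrable_finsetSum _ fun j _ => hleft i j,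
    integral_finsetSum _ fun i _ => integrable_finsetSum _ fun j _ => hright i j]
  refine Finset.sum_congr rfl fun i _ => ?_
  rw [integral_finsetSum _ fun j _ => hleft i j, integral_finsetSum _ fun j _ => hright i j]
  refine Finset.sum_congr rfl fun j _ => ?_
  have := hW.integral_increment_mul_increment (hab i) (hab j)
  simp only [mul_mul_mul_comm (c i) _ (c j), integral_const_mul, this]

variable [IsProbabilityMeasure P]

lemma martingale (hW : IsFilteredBrownian W F P) : Martingale W F P := by
  refine ⟨hW.adapted, fun s t hst => ?_⟩
  have hsub : MemLp (W t - W s) 2 P := (hW.memLp t).sub (hW.memLp s)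
  have hincr : P[W t - W s|F s] =ᵐ[P] fun _ => ∫ ω, (W t - W s) ω ∂P :=
    condExp_indep_eq (((hW.adapted t).mono (F.le t)).measurable.sub
      ((hW.adapted s).mono (F.le s)).measurable).comap_le (F.le s)
      (comap_measurable _).stronglyMeasurable (hW.indep s t hst)
  have h0 : ∫ ω, (W t - W s) ω ∂P = 0 := by
    simp only [Pi.sub_apply]
    rw [integral_sub ((hW.memLp t).integrable (by norm_num))
      ((hW.memLp s).integrable (by norm_num)), hW.mean, hW.mean, sub_zero]
  have hadd := condExp_sub ((hW.memLp t).integrable (by norm_num))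
    ((hW.memLp s).integrable (by norm_num)) (F s)
  rw [condExp_of_stronglyMeasurable (F.le s) (hW.adapted s)
    ((hW.memLp s).integrable (by norm_num))] at hadd
  filter_upwards [hincr, hadd] with ω h1 h2
  rw [h0] at h1
  rw [h1, Pi.sub_apply] at h2
  linarith

/-- A Brownian motion stopped at a deterministic time is a martingale. -/
lemma martingale_min (hW : IsFilteredBrownian W F P) (b : ℝ≥0) :
    Martingale (fun s => W (min b s)) F P := by
  refine ⟨fun s => (hW.adapted _).mono (F.mono (min_le_right _ _)), fun s t hst => ?_⟩
  rcases le_total b s with hbs | hsb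
  · simp only [min_eq_left hbs, min_eq_left (hbs.trans hst)]
    rw [condExp_of_stronglyMeasurable (F.le s) ((hW.adapted b).mono (F.mono hbs))
        ((hW.memLp b).integrable (by norm_num))]
  · simp only [min_eq_right hsb]
    exact hW.martingale.condExp_ae_eq (le_min hsb hst)

lemma indep_increment_min (hW : IsFilteredBrownian W F P) {a b : ℝ≥0} (hab : a ≤ b) (s : ℝ≥0) :
    Indep (MeasurableSpace.comap (fun ω => W (min b s) ω - W (min a s) ω) inferInstance)
      (F a) P := by
  rcases le_total a s with has | hsa
  · rw [min_eq_left has]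
    exact hW.indep a _ (le_min hab has)
  · rw [min_eq_right hsa, min_eq_right (hsa.trans hab)]
    simp only [sub_self, MeasurableSpace.comap_const]
    exact indep_bot_left _

lemma indepFun_increment_min (hW : IsFilteredBrownian W F P) {a b : ℝ≥0} (hab : a ≤ b) (s : ℝ≥0)
    {X : Ω → ℝ} (hX : StronglyMeasurable[F a] X) :
    IndepFun X (fun ω => W (min b s) ω - W (min a s) ω) P := by
  rw [IndepFun_iff_Indep]
  exact (indep_of_indep_of_le_right (hW.indep_increment_min hab s) hX.measurable.comap_le).symm

lemma integral_increment_eq_zero (hW : IsFilteredBrownian W F P) (s t : ℝ≥0) :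
    ∫ ω, (W t ω - W s ω) ∂P = 0 := by
  rw [integral_sub ((hW.memLp t).integrable (by norm_num))
    ((hW.memLp s).integrable (by norm_num)), hW.mean, hW.mean, sub_zero]

/-- The Itô isometry for one-dimensional simple processes. -/
lemma integral_sq_sum (hW : IsFilteredBrownian W F P) {t : ℕ → ℝ≥0} (ht : Monotone t)
    {ξ : ℕ → Ω → ℝ} (hξ : ∀ i, StronglyMeasurable[F (t i)] (ξ i))
    (hb : ∀ i, ∃ C : ℝ, ∀ ω, ‖ξ i ω‖ ≤ C) (s : ℝ≥0) (n : ℕ) :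
    MemLp (fun ω => ∑ i ∈ Finset.range n, ξ i ω * (W (min (t (i + 1)) s) ω - W (min (t i) s) ω))
      2 P ∧
    ∫ ω, (∑ i ∈ Finset.range n,
        ξ i ω * (W (min (t (i + 1)) s) ω - W (min (t i) s) ω)) ^ 2 ∂P =
      ∑ i ∈ Finset.range n, (∫ ω, ξ i ω ^ 2 ∂P) * (min (t (i + 1)) s - min (t i) s : ℝ≥0) := by
  have hD : ∀ i, MemLp (fun ω => W (min (t (i + 1)) s) ω - W (min (t i) s) ω) 2 P := fun i =>
    (hW.memLp _).sub (hW.memLp _)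
  have hξm : ∀ i, AEStronglyMeasurable (ξ i) P := fun i =>
    ((hξ i).mono (F.le _)).aestronglyMeasurable
  have hξD : ∀ i, MemLp (fun ω => ξ i ω * (W (min (t (i + 1)) s) ω - W (min (t i) s) ω)) 2 P := by
    intro i
    obtain ⟨C, hC⟩ := hb i
    exact (hD i).mul (MemLp.of_bound (p := ∞) (hξm i) C (ae_of_all _ hC))
  have hmeas : ∀ n, StronglyMeasurable[F (t n)] fun ω => ∑ i ∈ Finset.range n,
      ξ i ω * (W (min (t (i + 1)) s) ω - W (min (t i) s) ω) := by
    intro n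
    refine Finset.stronglyMeasurable_fun_sum _ fun i hi => ?_
    have hin : i + 1 ≤ n := Finset.mem_range.1 hi
    have hi' : t i ≤ t n := ht (by omega)
    exact ((hξ i).mono (F.mono hi')).mul
      (((hW.adapted _).mono (F.mono ((min_le_left _ _).trans (ht hin)))).sub
        ((hW.adapted _).mono (F.mono ((min_le_left _ _).trans hi'))))
  have hS : ∀ n, MemLp (fun ω => ∑ i ∈ Finset.range n,
      ξ i ω * (W (min (t (i + 1)) s) ω - W (min (t i) s) ω)) 2 P := fun n =>
    memLp_finsetSum _ fun i _ => hξD i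
  refine ⟨hS n, ?_⟩
  induction n with
  | zero => simp
  | succ n ih =>
    simp only [Finset.sum_range_succ _ n]
    set S : Ω → ℝ := fun ω => ∑ i ∈ Finset.range n,
      ξ i ω * (W (min (t (i + 1)) s) ω - W (min (t i) s) ω) with hSdef
    set D : Ω → ℝ := fun ω => W (min (t (n + 1)) s) ω - W (min (t n) s) ω with hDdef
    have hle : t n ≤ t (n + 1) := ht (by omega)
    -- the cross term vanishes because `S * ξ n` is known at time `t n`
    have hcross : ∫ ω, (S ω * ξ n ω) * D ω ∂P = 0 := by
      have hi : IndepFun (fun ω => S ω * ξ n ω) D P :=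
        hW.indepFun_increment_min hle s ((hmeas n).mul (hξ n))
      rw [hi.integral_fun_mul_eq_mul_integral ((hS n).1.mul (hξm n)) (hD n).1]
      simp [hDdef, hW.integral_increment_eq_zero]
    have hsq : ∫ ω, ξ n ω ^ 2 * D ω ^ 2 ∂P =
        (∫ ω, ξ n ω ^ 2 ∂P) * (min (t (n + 1)) s - min (t n) s : ℝ≥0) := by
      have hi := (hW.indepFun_increment_min hle s (hξ n)).comp
        (φ := fun x => x ^ 2) (ψ := fun x => x ^ 2) (by fun_prop) (by fun_prop)
      have := hi.integral_fun_mul_eq_mul_integral ((hξm n).pow 2) ((hD n).1.pow 2)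
      simp only [Function.comp_apply] at this
      rw [this, hW.mean_sq _ _ (min_le_min_right s hle),
        NNReal.coe_sub (min_le_min_right s hle)]
    have h1 : Integrable (fun ω => S ω ^ 2) P := (hS n).integrable_sq
    have h2 : Integrable (fun ω => (ξ n ω * D ω) ^ 2) P := (hξD n).integrable_sq
    have h3 : Integrable (fun ω => 2 * (S ω * (ξ n ω * D ω))) P :=
      ((hS n).integrable_mul (hξD n)).const_mul 2
    have h4 : Integrable (fun ω => 2 * (S ω * (ξ n ω * D ω)) + (ξ n ω * D ω) ^ 2) P := h3.add h2
    calc ∫ ω, (S ω + ξ n ω * D ω) ^ 2 ∂P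
        = ∫ ω, (S ω ^ 2 + (2 * (S ω * (ξ n ω * D ω)) + (ξ n ω * D ω) ^ 2)) ∂P := by
          congr 1; ext ω; ring
      _ = ∫ ω, S ω ^ 2 ∂P + (2 * ∫ ω, (S ω * ξ n ω) * D ω ∂P + ∫ ω, ξ n ω ^ 2 * D ω ^ 2 ∂P) := by
          rw [integral_add h1 h4, integral_add h3 h2,
            integral_const_mul]
          simp only [mul_pow, mul_assoc]
      _ = _ := by rw [hcross, hsq, ih]; ring

/-- An elementary stochastic integral has mean zero. -/
lemma integral_sum_eq_zero (hW : IsFilteredBrownian W F P) {t : ℕ → ℝ≥0} (ht : Monotone t)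
    {ξ : ℕ → Ω → ℝ} (hξ : ∀ i, StronglyMeasurable[F (t i)] (ξ i))
    (hb : ∀ i, ∃ C : ℝ, ∀ ω, ‖ξ i ω‖ ≤ C) (s : ℝ≥0) (n : ℕ) :
    ∫ ω, (∑ i ∈ Finset.range n,
      ξ i ω * (W (min (t (i + 1)) s) ω - W (min (t i) s) ω)) ∂P = 0 := by
  have hξm : ∀ i, AEStronglyMeasurable (ξ i) P := fun i =>
    ((hξ i).mono (F.le _)).aestronglyMeasurable
  have hD : ∀ i, MemLp (fun ω => W (min (t (i + 1)) s) ω - W (min (t i) s) ω) 2 P := fun i =>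
    (hW.memLp _).sub (hW.memLp _)
  rw [integral_finsetSum]
  · refine Finset.sum_eq_zero fun i _ => ?_
    have hi := hW.indepFun_increment_min (ht (Nat.le_succ i)) s (hξ i)
    rw [hi.integral_fun_mul_eq_mul_integral (hξm i) (hD i).1, hW.integral_increment_eq_zero,
      mul_zero]
  · intro i _
    obtain ⟨C, hC⟩ := hb i
    exact ((hD i).mul (MemLp.of_bound (p := ∞) (hξm i) C (ae_of_all _ hC)) :
      MemLp _ 2 P).integrable (by norm_num)

end IsFilteredBrownian

/-! ### Predictable processes -/

section Predictable

variable {Ω : Type*} [mΩ : MeasurableSpace Ω] {F : Filtration ℝ≥0 mΩ}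

lemma measurable_fst_predictable : Measurable[F.predictable] (Prod.fst : ℝ≥0 × Ω → ℝ≥0) := by
  let := F.predictable
  refine measurable_of_Ioi fun a => ?_
  have h := measurableSet_predictable_Ioi_prod (𝓕 := F) (i := a) (s := Set.univ) MeasurableSet.univ
  rwa [Set.prod_univ] at h

lemma measurableSet_predictable_univ_prod {A : Set Ω} (hA : MeasurableSet[F 0] A) :
    MeasurableSet[F.predictable] ((Set.univ : Set ℝ≥0) ×ˢ A) := by
  have h1 := measurableSet_predictable_Ioi_prod (𝓕 := F) (i := 0) hA
  have h2 := measurableSet_predictable_singleton_bot_prod (𝓕 := F) (s := A) hA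
  have : (Set.univ : Set ℝ≥0) ×ˢ A = Set.Ioi 0 ×ˢ A ∪ {⊥} ×ˢ A := by
    rw [← Set.union_prod]
    congr 1
    ext s
    simp
  rw [this]
  exact h1.union h2

/-- The last point of the grid `{j / (m + 1)}` strictly before `s`, or `0` if `s = 0`. -/
noncomputable def gridPred (m : ℕ) (s : ℝ≥0) : ℝ≥0 := ((⌈s * (m + 1)⌉₊ - 1 : ℕ) : ℝ≥0) / (m + 1)

lemma tendsto_gridPred (s : ℝ≥0) : Tendsto (fun m => gridPred m s) atTop (𝓝 s) := by
  have hle : ∀ m : ℕ, gridPred m s ≤ s := by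
    intro m
    rw [gridPred, div_le_iff₀ (by positivity)]
    rcases Nat.eq_zero_or_pos ⌈s * (m + 1)⌉₊ with h | h
    · simp [h]
    · refine (Nat.lt_ceil.1 (Nat.sub_lt h one_pos)).le
  have hge : ∀ m : ℕ, s - 1 / (m + 1) ≤ gridPred m s := by
    intro m
    rw [tsub_le_iff_right, gridPred, ← add_div, le_div_iff₀ (by positivity)]
    refine (Nat.le_ceil _).trans ?_
    exact_mod_cast (by omega : ⌈s * (m + 1)⌉₊ ≤ ⌈s * (m + 1)⌉₊ - 1 + 1)
  refine tendsto_of_tendsto_of_tendsto_of_le_of_le ?_ tendsto_const_nhds hge hle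
  have h0 : Tendsto (fun m : ℕ => (1 : ℝ≥0) / (m + 1)) atTop (𝓝 0) :=
    tendsto_one_div_add_atTop_nhds_zero_nat
  simpa using (tendsto_const_nhds (x := s)).sub h0

variable {E : Type*} [TopologicalSpace E] [TopologicalSpace.PseudoMetrizableSpace E]
  [SecondCountableTopology E] [MeasurableSpace E] [BorelSpace E]

/-- An adapted process with continuous paths is predictable. -/
lemma isStronglyPredictable_of_continuous {u : ℝ≥0 → Ω → E} (hu : ∀ t, Measurable[F t] (u t))
    (hc : ∀ ω, Continuous fun t => u t ω) : IsStronglyPredictable F u := by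
  let : MeasurableSpace (ℝ≥0 × Ω) := F.predictable
  have hm : ∀ m : ℕ, Measurable fun p : ℝ≥0 × Ω => u (gridPred m p.1) p.2 := by
    intro m A hA
    have : (fun p : ℝ≥0 × Ω => u (gridPred m p.1) p.2) ⁻¹' A =
        ⋃ j : ℕ, (Prod.fst ⁻¹' {s : ℝ≥0 | ⌈s * (m + 1)⌉₊ = j}) ∩
          (Set.univ ×ˢ (u (((j - 1 : ℕ) : ℝ≥0) / (m + 1)) ⁻¹' A)) := by
      ext ⟨s, ω⟩
      simp [gridPred]
    rw [this]
    refine MeasurableSet.iUnion fun j => ?_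
    have hS : MeasurableSet {s : ℝ≥0 | ⌈s * (m + 1)⌉₊ = j} :=
      (Nat.measurable_ceil.comp (measurable_id.mul_const _)) (measurableSet_singleton j)
    have hS' := measurable_fst_predictable (F := F) hS
    rcases Nat.eq_zero_or_pos j with rfl | hj
    · refine hS'.inter (measurableSet_predictable_univ_prod ?_)
      simpa using hu 0 hA
    · have h2 := measurableSet_predictable_Ioi_prod (𝓕 := F)
        (hu (((j - 1 : ℕ) : ℝ≥0) / (m + 1)) hA)
      convert hS'.inter h2 using 1
      ext ⟨s, ω⟩
      simp only [Set.mem_inter_iff, Set.mem_preimage, Set.mem_ofPred_eq, Set.mem_prod, Set.mem_univ,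
        true_and, Set.mem_Ioi, and_congr_right_iff]
      intro hs
      have : ((j - 1 : ℕ) : ℝ≥0) / (m + 1) < s := by
        rw [div_lt_iff₀ (by positivity), ← Nat.lt_ceil]
        omega
      simp only [this, true_and]
  refine Measurable.stronglyMeasurable (measurable_of_tendsto_metrizable hm ?_)
  rw [tendsto_pi_nhds]
  exact fun p => ((hc p.2).tendsto p.1).comp (tendsto_gridPred p.1)

/-- A deterministic Borel function of time is predictable. -/
lemma isStronglyPredictable_of_deterministic {f : ℝ≥0 → E} (hf : Measurable f) :
    IsStronglyPredictable F (fun s (_ : Ω) => f s) := by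
  let : MeasurableSpace (ℝ≥0 × Ω) := F.predictable
  exact (hf.comp (measurable_fst_predictable (F := F))).stronglyMeasurable

lemma isPredictableUpTo_of_isStronglyPredictable {E : Type*} [TopologicalSpace E] [Zero E]
    {u : ℝ≥0 → Ω → E} (hu : IsStronglyPredictable F u) (τ : ℝ≥0) : IsPredictableUpTo F τ u := by
  let : MeasurableSpace (ℝ≥0 × Ω) := F.predictable
  have h : StronglyMeasurable ((Prod.fst ⁻¹' Set.Iic τ).indicator (Function.uncurry u)) :=
    StronglyMeasurable.indicator hu (measurable_fst_predictable (F := F) measurableSet_Iic)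
  have heq : Function.uncurry ((Set.Iic τ).indicator u) =
      (Prod.fst ⁻¹' Set.Iic τ).indicator (Function.uncurry u) := by
    ext ⟨s, ω⟩
    by_cases hs : s ≤ τ <;> simp [Function.uncurry, Set.indicator, hs]
  rw [IsPredictableUpTo, IsStronglyPredictable, heq]
  exact h

section Icc

variable {E : Type*} [NormedAddCommGroup E] [MeasurableSpace E] {τ : ℝ≥0} {f : ℝ → E}

lemma measurable_indicator_Icc (hf : Measurable fun s : Set.Icc (0 : ℝ) τ => f s) :
    Measurable ((Set.Icc (0 : ℝ) τ).indicator f) := by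
  refine measurable_of_restrict_of_restrict_compl
    (measurableSet_Icc (a := (0 : ℝ)) (b := τ)) ?_ ?_
  · convert hf using 1
    ext s : 1
    exact Set.indicator_of_mem s.2 f
  · convert measurable_const (a := (0 : E)) using 1
    ext s : 1
    exact Set.indicator_of_notMem s.2 f

lemma aemeasurable_restrict_Icc (hf : Measurable fun s : Set.Icc (0 : ℝ) τ => f s) :
    AEMeasurable f (volume.restrict (Set.Icc (0 : ℝ) τ)) :=
  (aemeasurable_indicator_iff measurableSet_Icc).1 (measurable_indicator_Icc hf).aemeasurable

/-- A deterministic function that is Borel on `[0, τ]` is predictable on `[0, τ]`. -/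
lemma isPredictableUpTo_of_measurable_Icc [SecondCountableTopology E] [BorelSpace E]
    (hf : Measurable fun s : Set.Icc (0 : ℝ) τ => f s) :
    IsPredictableUpTo F τ (fun s (_ : Ω) => f s) := by
  have h2 := isPredictableUpTo_of_isStronglyPredictable (isStronglyPredictable_of_deterministic
    (F := F) ((measurable_indicator_Icc hf).comp measurable_coe_nnreal_real)) τ
  rw [IsPredictableUpTo] at h2 ⊢
  convert h2 using 1
  ext s ω : 2
  by_cases hs : s ≤ τ <;> simp [Set.indicator, hs]

end Icc

lemma IsPredictableUpTo.add {E : Type*} [NormedAddCommGroup E] {τ : ℝ≥0} {u v : ℝ≥0 → Ω → E}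
    (hu : IsPredictableUpTo F τ u) (hv : IsPredictableUpTo F τ v) :
    IsPredictableUpTo F τ (fun s ω => u s ω + v s ω) := by
  let : MeasurableSpace (ℝ≥0 × Ω) := F.predictable
  have h : StronglyMeasurable (Function.uncurry ((Set.Iic τ).indicator u) +
      Function.uncurry ((Set.Iic τ).indicator v)) := StronglyMeasurable.add hu hv
  rw [IsPredictableUpTo, IsStronglyPredictable]
  convert h using 1
  ext ⟨s, ω⟩ : 1
  by_cases hs : s ≤ τ <;> simp [Function.uncurry, Set.indicator, hs]

/-- The time-`s` value of a process that is predictable up to `τ ≥ s` is a random variable. -/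
lemma IsPredictableUpTo.stronglyMeasurable {E : Type*} [NormedAddCommGroup E] {τ : ℝ≥0}
    {u : ℝ≥0 → Ω → E} (hu : IsPredictableUpTo F τ u) {s : ℝ≥0} (hs : s ≤ τ) :
    StronglyMeasurable (u s) := by
  have := (hu.stronglyAdapted s).mono (F.le s)
  rwa [Set.indicator_of_mem (show s ∈ Set.Iic τ from hs)] at this

end Predictable

/-! ### Sequences bounded in `L²` -/

section L2Bounded

variable {Ω : Type*} [mΩ : MeasurableSpace Ω] {P : Measure Ω} {E : Type*} [NormedAddCommGroup E]

lemma eLpNorm_two_le_of_integral_le {f : Ω → E} (hf : MemLp f 2 P) {C : ℝ}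
    (hC : ∫ ω, ‖f ω‖ ^ 2 ∂P ≤ C) : eLpNorm f 2 P ≤ ENNReal.ofReal √C := by
  rw [hf.eLpNorm_eq_integral_rpow_norm (by norm_num) (by norm_num)]
  refine ENNReal.ofReal_le_ofReal ?_
  simp only [ENNReal.toReal_ofNat, Real.rpow_ofNat]
  rw [← one_div, ← Real.sqrt_eq_rpow]
  exact Real.sqrt_le_sqrt hC

lemma unifIntegrable_of_eLpNorm_two_le {f : ℕ → Ω → E} (hf : ∀ k, AEStronglyMeasurable (f k) P)
    {C : ℝ≥0} (hC : ∀ k, eLpNorm (f k) 2 P ≤ C) : UnifIntegrable f 1 P := by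
  intro ε hε
  refine ⟨(ε / (C + 1)) ^ 2, by positivity, fun k s hs hμ => ?_⟩
  rw [eLpNorm_indicator_eq_eLpNorm_restrict hs]
  have h1 := eLpNorm_le_eLpNorm_mul_rpow_measure_univ (p := 1) (q := 2) (μ := P.restrict s)
    (by norm_num) (hf k).restrict
  have h2 : (P.restrict s) Set.univ ^ (1 / (1 : ℝ≥0∞).toReal - 1 / (2 : ℝ≥0∞).toReal) ≤
      ENNReal.ofReal (ε / (C + 1)) := by
    rw [Measure.restrict_apply_univ]
    calc P s ^ (1 / (1 : ℝ≥0∞).toReal - 1 / (2 : ℝ≥0∞).toReal)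
        ≤ ENNReal.ofReal ((ε / (C + 1)) ^ 2) ^
            (1 / (1 : ℝ≥0∞).toReal - 1 / (2 : ℝ≥0∞).toReal) := by
          gcongr
          norm_num
      _ = ENNReal.ofReal (ε / (C + 1)) := by
          rw [ENNReal.ofReal_rpow_of_nonneg (by positivity) (by norm_num)]
          congr 1
          norm_num
          rw [← Real.sqrt_eq_rpow, Real.sqrt_sq (by positivity)]
  refine h1.trans ((mul_le_mul' ((eLpNorm_mono_measure _ Measure.restrict_le_self).trans (hC k))
    h2).trans ?_)
  rw [← ENNReal.ofReal_coe_nnreal, ← ENNReal.ofReal_mul (by positivity)]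
  refine ENNReal.ofReal_le_ofReal ?_
  rw [mul_div_assoc', div_le_iff₀ (by positivity)]
  nlinarith [C.2]

/-- A limit in measure of centred random variables that are bounded in `L²` is square integrable
and centred. -/
lemma memLp_and_integral_eq_zero_of_tendstoInMeasure [NormedSpace ℝ E] [IsFiniteMeasure P]
    {X : ℕ → Ω → E} {M : Ω → E}
    (hX : ∀ k, MemLp (X k) 2 P) {C : ℝ} (hC : ∀ k, ∫ ω, ‖X k ω‖ ^ 2 ∂P ≤ C)
    (h0 : ∀ k, ∫ ω, X k ω ∂P = 0) (hM : AEStronglyMeasurable M P)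
    (hlim : TendstoInMeasure P X atTop M) : MemLp M 2 P ∧ ∫ ω, M ω ∂P = 0 := by
  have hb : ∀ k, eLpNorm (X k) 2 P ≤ (Real.toNNReal √C : ℝ≥0) := fun k =>
    eLpNorm_two_le_of_integral_le (hX k) (hC k)
  have hM2 : MemLp M 2 P := ⟨hM, (eLpNorm_le_of_tendstoInMeasure (Eventually.of_forall hb) hlim
    fun k => (hX k).1).trans_lt ENNReal.coe_lt_top⟩
  refine ⟨hM2, ?_⟩
  have hL1 := tendsto_Lp_finite_of_tendstoInMeasure le_rfl ENNReal.one_ne_top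
    (fun k => (hX k).1) (hM2.mono_exponent (by norm_num))
    (unifIntegrable_of_eLpNorm_two_le (fun k => (hX k).1) hb) hlim
  have := tendsto_integral_of_L1' M hM
    (Eventually.of_forall fun k => (hX k).integrable (by norm_num)) hL1
  simp only [h0] at this
  exact (tendsto_nhds_unique this tendsto_const_nhds)

end L2Bounded

/-! ### Itô integrals of simple processes -/

namespace SimpleProcess

variable {Ω : Type*} [mΩ : MeasurableSpace Ω] {F : Filtration ℝ≥0 mΩ} {n d : ℕ}

/-- The length of the part of the `i`-th interval of constancy of `S` that lies before time `s`. -/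
noncomputable def len (S : SimpleProcess n d F) (s : ℝ≥0) (i : ℕ) : ℝ≥0 :=
  min (S.time (i + 1)) s - min (S.time i) s

lemma notMem_Ioc_of_ne (S : SimpleProcess n d F) {s : ℝ≥0} {i j : ℕ} (hji : j ≠ i)
    (his : s ∈ Set.Ioc (S.time i) (S.time (i + 1))) :
    s ∉ Set.Ioc (S.time j) (S.time (j + 1)) := by
  intro hjs
  rcases lt_or_gt_of_ne hji with hlt | hlt
  · exact absurd (his.1.trans_le (hjs.2.trans (S.time_mono hlt))) (lt_irrefl _)
  · exact absurd (hjs.1.trans_le (his.2.trans (S.time_mono hlt))) (lt_irrefl _)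

lemma eval_of_mem (S : SimpleProcess n d F) {s : ℝ≥0} {i : ℕ} (hi : i < S.steps)
    (his : s ∈ Set.Ioc (S.time i) (S.time (i + 1))) (ω : Ω) : S.eval s ω = S.value i ω := by
  rw [SimpleProcess.eval, Finset.sum_eq_single_of_mem i (Finset.mem_range.2 hi) fun j _ hj =>
    Set.indicator_of_notMem (S.notMem_Ioc_of_ne hj his) _, Set.indicator_of_mem his]

lemma norm_eval_sq (S : SimpleProcess n d F) (s : ℝ≥0) (ω : Ω) :
    ‖S.eval s ω‖ₑ ^ 2 = ∑ i ∈ Finset.range S.steps,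
      (Set.Ioc (S.time i) (S.time (i + 1))).indicator (fun _ => ‖S.value i ω‖ₑ ^ 2) s := by
  by_cases h : ∃ i ∈ Finset.range S.steps, s ∈ Set.Ioc (S.time i) (S.time (i + 1))
  · obtain ⟨i, hi, his⟩ := h
    rw [S.eval_of_mem (Finset.mem_range.1 hi) his, Finset.sum_eq_single_of_mem i hi fun j _ hj =>
      Set.indicator_of_notMem (S.notMem_Ioc_of_ne hj his) _, Set.indicator_of_mem his]
  · push Not at h
    rw [SimpleProcess.eval, Finset.sum_eq_zero fun i hi => Set.indicator_of_notMem (h i hi) _,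
      Finset.sum_eq_zero fun i hi => Set.indicator_of_notMem (h i hi) _]
    simp

lemma lintegral_norm_eval_sq (S : SimpleProcess n d F) (s : ℝ≥0) (ω : Ω) :
    ∫⁻ r in Set.Icc (0 : ℝ) s, ‖S.eval r.toNNReal ω‖ₑ ^ 2 =
      ∑ i ∈ Finset.range S.steps, ‖S.value i ω‖ₑ ^ 2 * S.len s i := by
  simp only [norm_eval_sq]
  have hset : ∀ i, MeasurableSet {r : ℝ | r.toNNReal ∈ Set.Ioc (S.time i) (S.time (i + 1))} :=
    fun i => measurable_real_toNNReal measurableSet_Ioc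
  have hind : ∀ i, (fun r : ℝ => (Set.Ioc (S.time i) (S.time (i + 1))).indicator
      (fun _ => ‖S.value i ω‖ₑ ^ 2) r.toNNReal) =
      {r : ℝ | r.toNNReal ∈ Set.Ioc (S.time i) (S.time (i + 1))}.indicator
        fun _ => ‖S.value i ω‖ₑ ^ 2 := fun i => rfl
  rw [lintegral_finsetSum _ fun i _ => by
    rw [hind]; exact measurable_const.indicator (hset i)]
  refine Finset.sum_congr rfl fun i _ => ?_
  rw [hind, lintegral_indicator_const (hset i), Measure.restrict_apply (hset i)]
  congr 1
  have hle : S.time i ≤ S.time (i + 1) := S.time_mono (Nat.le_succ i)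
  have : {r : ℝ | r.toNNReal ∈ Set.Ioc (S.time i) (S.time (i + 1))} ∩ Set.Icc (0 : ℝ) s =
      Set.Ioc ((min (S.time i) s : ℝ≥0) : ℝ) (min (S.time (i + 1)) s : ℝ≥0) := by
    ext r
    simp only [Set.mem_inter_iff, Set.mem_ofPred_eq, Set.mem_Ioc, Set.mem_Icc, NNReal.coe_min,
      le_min_iff, min_lt_iff, Real.lt_toNNReal_iff_coe_lt, Real.toNNReal_le_iff_le_coe]
    constructor
    · rintro ⟨⟨h1, h2⟩, h3, h4⟩
      exact ⟨Or.inl h1, h2, h4⟩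
    · rintro ⟨h1, h2, h3⟩
      have h1' : (S.time i : ℝ) < r := h1.resolve_right (not_lt.2 h3)
      exact ⟨⟨h1', h2⟩, (S.time i).2.trans h1'.le, h3⟩
  rw [this, Real.volume_Ioc, len, ← NNReal.coe_sub (min_le_min_right s hle),
    ENNReal.ofReal_coe_nnreal]

lemma integral_apply (S : SimpleProcess n d F) (B : ℝ≥0 → Ω → Vec d) (s : ℝ≥0) (ω : Ω)
    (a : Fin n) : S.integral B s ω a = ∑ j, ∑ i ∈ Finset.range S.steps,
      S.value i ω (a, j) * (B (min (S.time (i + 1)) s) ω j - B (min (S.time i) s) ω j) := by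
  rw [SimpleProcess.integral, Finset.sum_comm]
  simp [mulVec, WithLp.ofLp_sum, Finset.sum_apply]

lemma stronglyMeasurable_value_apply (S : SimpleProcess n d F) (i : ℕ) (p : Fin n × Fin d) :
    StronglyMeasurable[F (S.time i)] fun ω => S.value i ω p :=
  (EuclideanSpace.proj (𝕜 := ℝ) p).continuous.comp_stronglyMeasurable (S.measurable_value i)

lemma bounded_value_apply (S : SimpleProcess n d F) (i : ℕ) (p : Fin n × Fin d) :
    ∃ C : ℝ, ∀ ω, ‖S.value i ω p‖ ≤ C := by
  obtain ⟨C, hC⟩ := S.bounded_value i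
  exact ⟨C, fun ω => (PiLp.norm_apply_le _ p).trans (hC ω)⟩

variable {P : Measure Ω} [IsProbabilityMeasure P] {B : ℝ≥0 → Ω → Vec d}

lemma memLp_value (S : SimpleProcess n d F) (i : ℕ) : MemLp (S.value i) 2 P := by
  obtain ⟨C, hC⟩ := S.bounded_value i
  exact MemLp.of_bound ((S.measurable_value i).mono (F.le _)).aestronglyMeasurable C
    (ae_of_all _ hC)

lemma memLp_integral (S : SimpleProcess n d F)
    (hB : ∀ j, IsFilteredBrownian (fun t ω => B t ω j) F P) (s : ℝ≥0) :
    MemLp (S.integral B s) 2 P := by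
  rw [memLp_piLp_iff]
  intro a
  simp only [integral_apply]
  exact memLp_finsetSum _ fun j _ => ((hB j).integral_sq_sum S.time_mono
    (fun i => S.stronglyMeasurable_value_apply i (a, j))
    (fun i => S.bounded_value_apply i (a, j)) s S.steps).1

lemma integral_integral_eq_zero (S : SimpleProcess n d F)
    (hB : ∀ j, IsFilteredBrownian (fun t ω => B t ω j) F P) (s : ℝ≥0) :
    ∫ ω, S.integral B s ω ∂P = 0 := by
  have hi : ∀ a, Integrable (fun ω => S.integral B s ω a) P :=
    integrable_piLp_iff.1 ((S.memLp_integral hB s).integrable (by norm_num))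
  ext a
  rw [eval_integral_piLp hi]
  simp only [integral_apply]
  rw [integral_finsetSum]
  · exact Finset.sum_eq_zero fun j _ => (hB j).integral_sum_eq_zero S.time_mono
      (fun i => S.stronglyMeasurable_value_apply i (a, j))
      (fun i => S.bounded_value_apply i (a, j)) s S.steps
  · exact fun j _ => ((hB j).integral_sq_sum S.time_mono
      (fun i => S.stronglyMeasurable_value_apply i (a, j))
      (fun i => S.bounded_value_apply i (a, j)) s S.steps).1.integrable (by norm_num)

/-- The second moment bound for integrals of simple processes. The factor `d` is not sharp; it
avoids the use of the independence of the components of `B`. -/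
lemma integral_norm_integral_sq_le (S : SimpleProcess n d F)
    (hB : ∀ j, IsFilteredBrownian (fun t ω => B t ω j) F P) (s : ℝ≥0) :
    ∫ ω, ‖S.integral B s ω‖ ^ 2 ∂P ≤
      d * ∫ ω, ∑ i ∈ Finset.range S.steps, ‖S.value i ω‖ ^ 2 * S.len s i ∂P := by
  set X : Fin n → Fin d → Ω → ℝ := fun a j ω => ∑ i ∈ Finset.range S.steps,
      S.value i ω (a, j) * (B (min (S.time (i + 1)) s) ω j - B (min (S.time i) s) ω j) with hX
  have hiso : ∀ a j, MemLp (X a j) 2 P ∧ ∫ ω, X a j ω ^ 2 ∂P = ∑ i ∈ Finset.range S.steps,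
      (∫ ω, S.value i ω (a, j) ^ 2 ∂P) * S.len s i := fun a j =>
    (hB j).integral_sq_sum S.time_mono (fun i => S.stronglyMeasurable_value_apply i (a, j))
      (fun i => S.bounded_value_apply i (a, j)) s S.steps
  have hvi : ∀ i (p : Fin n × Fin d), Integrable (fun ω => S.value i ω p ^ 2) P := fun i p =>
    (memLp_piLp_iff.1 (S.memLp_value (P := P) i) p).integrable_sq
  calc ∫ ω, ‖S.integral B s ω‖ ^ 2 ∂P
      ≤ ∫ ω, ∑ a, d * ∑ j, X a j ω ^ 2 ∂P := by
        refine integral_mono (S.memLp_integral hB s).norm.integrable_sq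
          (integrable_finsetSum _ fun a _ => (integrable_finsetSum _ fun j _ =>
            (hiso a j).1.integrable_sq).const_mul _) fun ω => ?_
        simp only [EuclideanSpace.norm_sq_eq, Real.norm_eq_abs, sq_abs, integral_apply]
        refine Finset.sum_le_sum fun a _ => ?_
        refine sq_sum_le_card_mul_sum_sq.trans (le_of_eq ?_)
        rw [Finset.card_univ, Fintype.card_fin]
    _ = ∑ a, d * ∑ j, ∑ i ∈ Finset.range S.steps,
          (∫ ω, S.value i ω (a, j) ^ 2 ∂P) * S.len s i := by
        rw [integral_finsetSum _ fun a _ => (integrable_finsetSum _ fun j _ =>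
            (hiso a j).1.integrable_sq).const_mul _]
        refine Finset.sum_congr rfl fun a _ => ?_
        rw [integral_const_mul, integral_finsetSum _ fun j _ => (hiso a j).1.integrable_sq]
        simp only [(hiso a _).2]
    _ = d * ∑ i ∈ Finset.range S.steps, (∑ p, ∫ ω, S.value i ω p ^ 2 ∂P) * S.len s i := by
        rw [← Finset.mul_sum]
        congr 1
        simp only [Finset.sum_mul]
        rw [Finset.sum_comm (s := Finset.range S.steps), Fintype.sum_prod_type]
    _ = _ := by
        rw [integral_finsetSum]
        · congr 1
          refine Finset.sum_congr rfl fun i _ => ?_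
          rw [integral_mul_const, ← integral_finsetSum _ fun p _ => hvi i p]
          simp only [EuclideanSpace.norm_sq_eq, Real.norm_eq_abs, sq_abs]
        · exact fun i _ => (S.memLp_value i).norm.integrable_sq.mul_const _

end SimpleProcess

/-! ### Continuity of the stochastic integral in probability -/

lemma enorm_sq_le_two_mul {E : Type*} [SeminormedAddCommGroup E] (x y : E) :
    ‖x‖ₑ ^ 2 ≤ 2 * ‖x - y‖ₑ ^ 2 + 2 * ‖y‖ₑ ^ 2 := by
  have h1 : ‖x‖ ^ 2 ≤ 2 * ‖x - y‖ ^ 2 + 2 * ‖y‖ ^ 2 := by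
    have := norm_add_le (x - y) y
    rw [sub_add_cancel] at this
    nlinarith [sq_nonneg (‖x - y‖ - ‖y‖), norm_nonneg x]
  rw [← ofReal_norm, ← ofReal_norm, ← ofReal_norm, ← ENNReal.ofReal_pow (norm_nonneg _),
    ← ENNReal.ofReal_pow (norm_nonneg _), ← ENNReal.ofReal_pow (norm_nonneg _)]
  refine (ENNReal.ofReal_le_ofReal h1).trans (le_of_eq ?_)
  rw [ENNReal.ofReal_add (by positivity) (by positivity), ENNReal.ofReal_mul (by norm_num),
    ENNReal.ofReal_mul (by norm_num)]
  norm_num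

lemma sum_ite_partial_sum_le {a : ℕ → ℝ} (ha : ∀ i, 0 ≤ a i) {δ : ℝ} (hδ : 0 ≤ δ) (m : ℕ) :
    ∑ i ∈ Finset.range m, (if ∑ j ∈ Finset.range (i + 1), a j ≤ δ then a i else 0) ≤
      min (∑ i ∈ Finset.range m, a i) δ := by
  induction m with
  | zero => simpa using hδ
  | succ m ih =>
    rw [Finset.sum_range_succ]
    have ha' := ha m
    by_cases h : ∑ j ∈ Finset.range (m + 1), a j ≤ δ
    · rw [if_pos h, min_eq_left h, Finset.sum_range_succ]
      linarith [ih.trans (min_le_left _ _)]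
    · rw [if_neg h, add_zero, Finset.sum_range_succ]
      exact ih.trans (min_le_min_right _ (by linarith))

namespace SimpleProcess

variable {Ω : Type*} [mΩ : MeasurableSpace Ω] {F : Filtration ℝ≥0 mΩ} {n d : ℕ}

/-- The simple process `S` stopped just before its accumulated energy `∫ ‖S‖²`, computed on
`[0, s]`, exceeds `δ`. The energy up to the end of the `i`-th interval is already known at
the beginning of that interval, so that the truncated process is again simple. -/
noncomputable def truncate (S : SimpleProcess n d F) (s : ℝ≥0) (δ : ℝ) : SimpleProcess n d F where
  steps := S.steps
  time := S.time
  time_mono := S.time_mono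
  value i := {ω | ∑ j ∈ Finset.range (i + 1), ‖S.value j ω‖ ^ 2 * S.len s j ≤ δ}.indicator
    (S.value i)
  measurable_value i := by
    refine (S.measurable_value i).indicator ?_
    refine @measurableSet_le _ _ _ _ _ (F (S.time i)) _ _ _ _ _ ?_ measurable_const
    refine Finset.measurable_fun_sum _ fun j hj => ?_
    have hji : S.time j ≤ S.time i := S.time_mono (Nat.lt_succ_iff.1 (Finset.mem_range.1 hj))
    exact ((((S.measurable_value j).mono (F.mono hji)).norm.measurable).pow_const 2).mul_const _
  bounded_value i := by
    obtain ⟨C, hC⟩ := S.bounded_value i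
    exact ⟨C, fun ω => (norm_indicator_le_norm_self _ _).trans (hC ω)⟩

lemma sum_truncate_le (S : SimpleProcess n d F) (s : ℝ≥0) {δ : ℝ} (hδ : 0 ≤ δ) (ω : Ω) :
    ∑ i ∈ Finset.range (S.truncate s δ).steps,
      ‖(S.truncate s δ).value i ω‖ ^ 2 * (S.truncate s δ).len s i ≤ δ := by
  have h := (sum_ite_partial_sum_le (a := fun i => ‖S.value i ω‖ ^ 2 * S.len s i)
    (fun i => by positivity) hδ S.steps).trans (min_le_right _ _)
  refine le_trans (le_of_eq (Finset.sum_congr rfl fun i _ => ?_)) h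
  by_cases hi : ∑ j ∈ Finset.range (i + 1), ‖S.value j ω‖ ^ 2 * S.len s j ≤ δ
  · rw [if_pos hi]
    have hv : (S.truncate s δ).value i ω = S.value i ω :=
      Set.indicator_of_mem (s := {ω | ∑ j ∈ Finset.range (i + 1),
        ‖S.value j ω‖ ^ 2 * (S.len s j : ℝ) ≤ δ}) hi _
    rw [hv]
    rfl
  · rw [if_neg hi]
    simp [truncate, Set.indicator, hi]

lemma sum_le_of_lintegral_le (S : SimpleProcess n d F) (s : ℝ≥0) {δ : ℝ} (hδ : 0 ≤ δ) {ω : Ω}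
    (h : ∫⁻ r in Set.Icc (0 : ℝ) s, ‖S.eval r.toNNReal ω‖ₑ ^ 2 ≤ ENNReal.ofReal δ) :
    ∑ i ∈ Finset.range S.steps, ‖S.value i ω‖ ^ 2 * S.len s i ≤ δ := by
  rw [lintegral_norm_eval_sq] at h
  rw [← ENNReal.ofReal_le_ofReal_iff hδ, ENNReal.ofReal_sum_of_nonneg fun i _ => by positivity]
  refine le_trans (le_of_eq (Finset.sum_congr rfl fun i _ => ?_)) h
  rw [ENNReal.ofReal_mul (by positivity), ENNReal.ofReal_pow (norm_nonneg _), ofReal_norm,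
    ENNReal.ofReal_coe_nnreal]

lemma integral_truncate_eq (S : SimpleProcess n d F) (B : ℝ≥0 → Ω → Vec d) (s : ℝ≥0) {δ : ℝ}
    (hδ : 0 ≤ δ) {ω : Ω}
    (h : ∫⁻ r in Set.Icc (0 : ℝ) s, ‖S.eval r.toNNReal ω‖ₑ ^ 2 ≤ ENNReal.ofReal δ) :
    (S.truncate s δ).integral B s ω = S.integral B s ω := by
  have hle := S.sum_le_of_lintegral_le s hδ h
  refine Finset.sum_congr rfl fun i hi => ?_
  have hi' : ∑ j ∈ Finset.range (i + 1), ‖S.value j ω‖ ^ 2 * S.len s j ≤ δ :=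
    (Finset.sum_le_sum_of_subset_of_nonneg
      (Finset.range_subset_range.2 (Finset.mem_range.1 hi)) fun _ _ _ => by positivity).trans hle
  simp [truncate, Set.indicator, hi']

variable {P : Measure Ω} {B : ℝ≥0 → Ω → Vec d}

lemma measure_integral_truncate_ne_le (S : SimpleProcess n d F) (B : ℝ≥0 → Ω → Vec d)
    (s : ℝ≥0) {δ : ℝ} (hδ : 0 ≤ δ) :
    P {ω | (S.truncate s δ).integral B s ω ≠ S.integral B s ω} ≤
      P {ω | ENNReal.ofReal δ ≤ ∫⁻ r in Set.Icc (0 : ℝ) s, ‖S.eval r.toNNReal ω‖ₑ ^ 2} := by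
  refine measure_mono fun ω hω => ?_
  by_contra hlt
  exact hω (S.integral_truncate_eq B s hδ (not_le.1 hlt).le)

variable [IsProbabilityMeasure P]

lemma integral_norm_integral_truncate_sq_le (S : SimpleProcess n d F)
    (hB : ∀ j, IsFilteredBrownian (fun t ω => B t ω j) F P) (s : ℝ≥0) {δ : ℝ} (hδ : 0 ≤ δ) :
    ∫ ω, ‖(S.truncate s δ).integral B s ω‖ ^ 2 ∂P ≤ d * δ := by
  refine ((S.truncate s δ).integral_norm_integral_sq_le hB s).trans ?_
  gcongr
  calc _ ≤ ∫ _, δ ∂P := integral_mono_of_nonneg (ae_of_all _ fun ω => by positivity)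
        (integrable_const _) (ae_of_all _ fun ω => S.sum_truncate_le s hδ ω)
    _ = δ := by simp

/-- The stochastic integral is small in probability when the energy of the integrand is. -/
lemma measure_le_norm_integral_le (S : SimpleProcess n d F)
    (hB : ∀ j, IsFilteredBrownian (fun t ω => B t ω j) F P) (s : ℝ≥0) {δ a : ℝ} (hδ : 0 ≤ δ)
    (ha : 0 < a) :
    P {ω | a ≤ ‖S.integral B s ω‖} ≤
      P {ω | ENNReal.ofReal δ ≤ ∫⁻ r in Set.Icc (0 : ℝ) s, ‖S.eval r.toNNReal ω‖ₑ ^ 2} +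
        ENNReal.ofReal (d * δ / a ^ 2) := by
  have hmem := (S.truncate s δ).memLp_integral hB s
  have hcheb : P {ω | a ≤ ‖(S.truncate s δ).integral B s ω‖} ≤
      ENNReal.ofReal (d * δ / a ^ 2) := by
    have h1 := mul_meas_ge_le_integral_of_nonneg (ε := a ^ 2)
      (f := fun ω => ‖(S.truncate s δ).integral B s ω‖ ^ 2) (μ := P)
      (ae_of_all _ fun ω => by positivity) hmem.norm.integrable_sq
    have h2 : {ω | a ≤ ‖(S.truncate s δ).integral B s ω‖} =
        {ω | a ^ 2 ≤ ‖(S.truncate s δ).integral B s ω‖ ^ 2} := by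
      ext ω
      exact (sq_le_sq₀ ha.le (norm_nonneg _)).symm
    rw [h2, ← ofReal_measureReal]
    refine ENNReal.ofReal_le_ofReal ?_
    rw [le_div_iff₀' (by positivity)]
    exact h1.trans (S.integral_norm_integral_truncate_sq_le hB s hδ)
  calc P {ω | a ≤ ‖S.integral B s ω‖}
      ≤ P ({ω | (S.truncate s δ).integral B s ω ≠ S.integral B s ω} ∪
          {ω | a ≤ ‖(S.truncate s δ).integral B s ω‖}) := by
        refine measure_mono fun ω hω => ?_
        by_cases h : (S.truncate s δ).integral B s ω = S.integral B s ω
        · right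
          rwa [Set.mem_ofPred_eq, h]
        · exact Or.inl h
    _ ≤ _ := (measure_union_le _ _).trans
        (add_le_add (S.measure_integral_truncate_ne_le B s hδ) hcheb)

end SimpleProcess

/-! ### Itô integrals of deterministic integrands -/

section Deterministic

variable {Ω : Type*} [mΩ : MeasurableSpace Ω] {F : Filtration ℝ≥0 mΩ} {n d : ℕ}
  {P : Measure Ω} [IsProbabilityMeasure P] {B : ℝ≥0 → Ω → Vec d} {τ : ℝ≥0} {h : ℝ → Mat n d}
  {M : ℝ≥0 → Ω → Vec n}

/-- The Itô integral vanishes as long as its integrand does. -/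
lemma IsItoIntegral.ae_eq_zero (hB : ∀ j, IsFilteredBrownian (fun t ω => B t ω j) F P)
    (hM : IsItoIntegral P F B τ (fun s _ => h s) M) {s : ℝ≥0} (hs : s ≤ τ)
    (h0 : ∀ r ∈ Set.Ico (0 : ℝ) s, h r = 0) : M s =ᵐ[P] 0 := by
  obtain ⟨S, hS1, hS2⟩ := hM.approx
  refine tendstoInMeasure_ae_unique (hS2 s hs) ?_
  have hle : ∀ k ω, ∫⁻ r in Set.Icc (0 : ℝ) s, ‖(S k).eval r.toNNReal ω‖ₑ ^ 2 ≤
      ∫⁻ r in Set.Icc (0 : ℝ) τ, ‖(S k).eval r.toNNReal ω - h r.toNNReal‖ₑ ^ 2 := by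
    intro k ω
    rw [setLIntegral_congr Ico_ae_eq_Icc.symm]
    calc ∫⁻ r in Set.Ico (0 : ℝ) s, ‖(S k).eval r.toNNReal ω‖ₑ ^ 2
        = ∫⁻ r in Set.Ico (0 : ℝ) s, ‖(S k).eval r.toNNReal ω - h r.toNNReal‖ₑ ^ 2 := by
          refine setLIntegral_congr_fun measurableSet_Ico fun r hr => ?_
          simp only [Real.coe_toNNReal r hr.1, h0 r hr, sub_zero]
      _ ≤ _ := lintegral_mono_set (Set.Ico_subset_Icc_self.trans
          (Set.Icc_subset_Icc_right (by exact_mod_cast hs)))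
  rw [tendstoInMeasure_iff_norm]
  intro a ha
  simp only [Pi.zero_apply, sub_zero]
  rw [ENNReal.tendsto_nhds_zero]
  intro ε hε
  -- choose the energy threshold so that the second moment bound contributes at most `ε / 2`
  obtain ⟨η, hη, hηε⟩ : ∃ η : ℝ, 0 < η ∧ ENNReal.ofReal (d * η / a ^ 2) ≤ ε / 2 := by
    have hcont : Tendsto (fun η : ℝ => ENNReal.ofReal (d * η / a ^ 2)) (𝓝[>] 0) (𝓝 0) := by
      have : Continuous fun η : ℝ => ENNReal.ofReal (d * η / a ^ 2) :=
        ENNReal.continuous_ofReal.comp (by fun_prop)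
      simpa using (this.tendsto 0).mono_left nhdsWithin_le_nhds
    obtain ⟨η, h1, h2⟩ := ((hcont.eventually
      (ge_mem_nhds (ENNReal.half_pos hε.ne'))).and self_mem_nhdsWithin).exists
    exact ⟨η, h2, h1⟩
  have hlim := hS1 (ENNReal.ofReal η) (by simpa using hη)
  filter_upwards [hlim.eventually (ge_mem_nhds (ENNReal.half_pos hε.ne'))] with k hk
  refine ((S k).measure_le_norm_integral_le hB s hη.le ha).trans ?_
  refine (add_le_add ((measure_mono fun ω hω => le_trans hω (hle k ω)).trans hk) hηε).trans ?_
  rw [ENNReal.add_halves]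

/-- Every version of the Itô integral of a deterministic integrand is square integrable and
centred at all times. -/
lemma IsItoIntegral.memLp_and_integral_eq_zero
    (hB : ∀ j, IsFilteredBrownian (fun t ω => B t ω j) F P)
    (hh : MemDetL2 τ h)
    (hM : IsItoIntegral P F B τ (fun s _ => h s) M) {s : ℝ≥0} (hs : s ≤ τ) :
    MemLp (M s) 2 P ∧ ∫ ω, M s ω ∂P = 0 := by
  obtain ⟨S, hS1, hS2⟩ := hM.approx
  set V : ℝ≥0∞ := ∫⁻ r in Set.Icc (0 : ℝ) τ, ‖h r‖ₑ ^ 2 with hV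
  have hV_fin : V ≠ ∞ := hh.sq_integrable.ne
  -- `‖S‖² ≤ 2 ‖S - h‖² + 2 ‖h‖²`, so truncation at energy `2 V + 2` changes nothing where
  -- `∫ ‖S - h‖² < 1`
  set δ : ℝ := 2 * V.toReal + 2 with hδdef
  have hδ : 0 ≤ δ := by positivity
  have hδV : ENNReal.ofReal δ = 2 * V + 2 := by
    rw [hδdef, ENNReal.ofReal_add (by positivity) (by norm_num), ENNReal.ofReal_mul (by norm_num),
      ENNReal.ofReal_toReal hV_fin]
    norm_num
  have hmeas : AEMeasurable (fun r : ℝ => ‖h r‖ₑ ^ 2)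
      (volume.restrict (Set.Icc (0 : ℝ) τ)) :=
    (aemeasurable_restrict_Icc hh.measurable).enorm.pow_const 2
  have hle : ∀ k ω, ENNReal.ofReal δ ≤
      ∫⁻ r in Set.Icc (0 : ℝ) s, ‖(S k).eval r.toNNReal ω‖ₑ ^ 2 →
      1 ≤ ∫⁻ r in Set.Icc (0 : ℝ) τ, ‖(S k).eval r.toNNReal ω - h r.toNNReal‖ₑ ^ 2 := by
    intro k ω hω
    by_contra hlt
    rw [not_le] at hlt
    have : ∫⁻ r in Set.Icc (0 : ℝ) s, ‖(S k).eval r.toNNReal ω‖ₑ ^ 2 ≤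
        2 * (∫⁻ r in Set.Icc (0 : ℝ) τ, ‖(S k).eval r.toNNReal ω - h r.toNNReal‖ₑ ^ 2) + 2 * V := by
      calc _ ≤ ∫⁻ r in Set.Icc (0 : ℝ) τ, ‖(S k).eval r.toNNReal ω‖ₑ ^ 2 :=
            lintegral_mono_set (Set.Icc_subset_Icc_right (by exact_mod_cast hs))
        _ ≤ ∫⁻ r in Set.Icc (0 : ℝ) τ, (2 * ‖(S k).eval r.toNNReal ω - h r.toNNReal‖ₑ ^ 2 +
              2 * ‖h r‖ₑ ^ 2) := by
            refine setLIntegral_mono' measurableSet_Icc fun r hr => ?_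
            simp only [Real.coe_toNNReal r hr.1]
            exact enorm_sq_le_two_mul _ _
        _ = _ := by
            rw [lintegral_add_right' _ (hmeas.const_mul 2),
              lintegral_const_mul' _ _ (by norm_num), lintegral_const_mul' _ _ (by norm_num)]
    have hcontra : 2 * V + 2 < 2 * V + 2 := by
      calc 2 * V + 2 ≤ _ := hδV ▸ hω
        _ ≤ _ := this
        _ < 2 * 1 + 2 * V := by
            refine ENNReal.add_lt_add_right (ENNReal.mul_ne_top ENNReal.ofNat_ne_top hV_fin) ?_
            exact (ENNReal.mul_lt_mul_iff_right two_ne_zero ENNReal.ofNat_ne_top).2 hlt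
        _ = 2 * V + 2 := by rw [mul_one, add_comm]
    exact lt_irrefl _ hcontra
  refine memLp_and_integral_eq_zero_of_tendstoInMeasure
    (X := fun k => ((S k).truncate s δ).integral B s)
    (fun k => ((S k).truncate s δ).memLp_integral hB s)
    (fun k => (S k).integral_norm_integral_truncate_sq_le hB s hδ)
    (fun k => ((S k).truncate s δ).integral_integral_eq_zero hB s)
    (hM.integral_mem.predictable.stronglyMeasurable hs).aestronglyMeasurable ?_
  rw [tendstoInMeasure_iff_norm]
  intro a ha
  have hlim := ((tendstoInMeasure_iff_norm.1 (hS2 s hs)) a ha).add (hS1 1 one_pos)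
  rw [add_zero] at hlim
  refine tendsto_of_tendsto_of_tendsto_of_le_of_le tendsto_const_nhds hlim (fun _ => zero_le)
    fun k => ?_
  refine le_trans (measure_mono (t := {ω | a ≤ ‖(S k).integral B s ω - M s ω‖} ∪
    {ω | ((S k).truncate s δ).integral B s ω ≠ (S k).integral B s ω}) fun ω hω => ?_)
    ((measure_union_le _ _).trans (add_le_add_right
      (((S k).measure_integral_truncate_ne_le B s hδ).trans (measure_mono fun ω => hle k ω)) _))
  by_cases heq : ((S k).truncate s δ).integral B s ω = (S k).integral B s ω
  · left
    rwa [Set.mem_ofPred_eq, ← heq]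
  · exact Or.inr heq

end Deterministic

/-! ### A maximal inequality for continuous martingales -/

section Maximal

variable {Ω : Type*} [mΩ : MeasurableSpace Ω] {P : Measure Ω} [IsProbabilityMeasure P]
  {F : Filtration ℝ≥0 mΩ}

/-- Doob's maximal inequality on a finite grid. -/
lemma measure_le_sup_grid_le {Y : ℝ≥0 → Ω → ℝ} (hY : Martingale Y F P) (τ : ℝ≥0) {c : ℝ}
    (hc : 0 < c) (m : ℕ) :
    P {ω | ∃ j ≤ m + 1, c ≤ |Y (j / (m + 1) * τ) ω|} ≤
      ENNReal.ofReal ((∫ ω, |Y τ ω| ∂P) / c) := by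
  have hmono : Monotone fun j : ℕ => (j : ℝ≥0) / (m + 1) * τ := fun i j hij => by
    dsimp only
    gcongr
  let G : Filtration ℕ mΩ :=
    ⟨fun j => F (j / (m + 1) * τ), fun i j hij => F.mono (hmono hij), fun j => F.le _⟩
  have hsub : Submartingale (fun s ω => |Y s ω|) F P := hY.submartingale.sup hY.neg.submartingale
  have hsubG : Submartingale (fun (j : ℕ) ω => |Y (j / (m + 1) * τ) ω|) G P :=
    ⟨fun j => hsub.1 _, fun i j hij => hsub.2.1 _ _ (hmono hij), fun j => hsub.2.2 _⟩
  have hmax := maximal_ineq (ε := c.toNNReal) hsubG (fun j ω => abs_nonneg _) (m + 1)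
  have hlast : ((m + 1 : ℕ) : ℝ≥0) / (m + 1) * τ = τ := by
    push_cast
    rw [div_self (by positivity), one_mul]
  rw [hlast, Real.coe_toNNReal c hc.le] at hmax
  have hset : {ω | c ≤ (Finset.range (m + 1 + 1)).sup' Finset.nonempty_range_add_one
      fun k : ℕ => |Y (k / (m + 1) * τ) ω|} = {ω | ∃ j ≤ m + 1, c ≤ |Y (j / (m + 1) * τ) ω|} := by
    ext ω
    simp only [Finset.le_sup'_iff, Finset.mem_range, Nat.lt_succ_iff, Set.mem_ofPred_eq]
  rw [hset] at hmax
  have hint : (∫ ω in {ω | ∃ j ≤ m + 1, c ≤ |Y (j / (m + 1) * τ) ω|}, |Y τ ω| ∂P) ≤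
      ∫ ω, |Y τ ω| ∂P :=
    setIntegral_le_integral (hsub.2.2 τ) (ae_of_all _ fun ω => abs_nonneg _)
  rw [ENNReal.ofReal_div_of_pos hc, ENNReal.le_div_iff_mul_le (Or.inl (by simpa using hc))
    (Or.inl ENNReal.ofReal_ne_top), mul_comm]
  exact hmax.trans (ENNReal.ofReal_le_ofReal hint)

/-- Doob's maximal inequality for martingales with continuous paths. -/
lemma measure_exists_lt_abs_le {Y : ℝ≥0 → Ω → ℝ} (hY : Martingale Y F P)
    (hc : ∀ᵐ ω ∂P, Continuous fun s => Y s ω) (τ : ℝ≥0) {c : ℝ} (hc0 : 0 < c) :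
    P {ω | ∃ s ≤ τ, c < |Y s ω|} ≤ ENNReal.ofReal ((∫ ω, |Y τ ω| ∂P) / c) := by
  set E : ℕ → Set Ω := fun m => {ω | ∃ j ≤ m + 1, c ≤ |Y (j / (m + 1) * τ) ω|} with hE
  -- by continuity, a strict inequality at some time is seen by all sufficiently fine grids
  have hsub : {ω | ∃ s ≤ τ, c < |Y s ω|} ≤ᵐ[P] (⋃ m, ⋂ k ≥ m, E k : Set Ω) := by
    filter_upwards [hc] with ω hω
    rintro ⟨s, hs, hlt⟩
    have hlim : Tendsto (fun m => gridPred m (s / τ) * τ) atTop (𝓝 s) := by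
      have := (tendsto_gridPred (s / τ)).mul_const τ
      rcases eq_or_ne τ 0 with h0 | h0
      · have hs0 : s = 0 := le_antisymm (h0 ▸ hs) zero_le
        simp [h0, hs0]
      · rwa [div_mul_cancel₀ _ h0] at this
    have hev : ∀ᶠ m in atTop, c < |Y (gridPred m (s / τ) * τ) ω| :=
      (((hω.abs).tendsto s).comp hlim).eventually (lt_mem_nhds hlt)
    obtain ⟨m, hm⟩ := eventually_atTop.1 hev
    refine Set.mem_iUnion.2 ⟨m, Set.mem_iInter₂.2 fun k hk => ?_⟩
    refine ⟨⌈s / τ * (k + 1)⌉₊ - 1, ?_, (hm k hk).le⟩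
    refine (Nat.sub_le _ _).trans (Nat.ceil_le.2 ?_)
    have h1 : s / τ ≤ 1 := div_le_one_of_le₀ hs zero_le
    push_cast
    calc s / τ * (k + 1) ≤ 1 * (k + 1) := by gcongr
      _ = k + 1 := one_mul _
  refine (measure_mono_ae hsub).trans ?_
  have hmono : Monotone fun m => ⋂ k ≥ m, E k := fun i j hij =>
    Set.biInter_subset_biInter_left fun k hk => le_trans hij hk
  rw [hmono.measure_iUnion]
  refine iSup_le fun m => (measure_mono (Set.biInter_subset_of_mem (le_refl m))).trans ?_
  exact measure_le_sup_grid_le hY τ hc0 m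

end Maximal

/-! ### Approximation of deterministic integrands by step functions -/

section Approximation

variable {Ω : Type*} [mΩ : MeasurableSpace Ω] {F : Filtration ℝ≥0 mΩ} {n d : ℕ}

/-- A simple process whose values are not random. -/
def SimpleProcess.IsDeterministic (S : SimpleProcess n d F) : Prop :=
  ∃ c : ℕ → Mat n d, ∀ i ω, S.value i ω = c i

variable (F) in
/-- The deterministic simple process that interpolates the function `f` at the left end points of
the uniform partition of `[0, τ]` into `N + 1` intervals. -/
noncomputable def stepProcess (τ : ℝ≥0) (N : ℕ) (f : ℝ → Mat n d) : SimpleProcess n d F where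
  steps := N + 1
  time i := i / (N + 1) * τ
  time_mono i j hij := by
    dsimp only
    gcongr
  value i _ := f ((i / (N + 1) * τ : ℝ≥0) : ℝ)
  measurable_value i := stronglyMeasurable_const
  bounded_value i := ⟨_, fun _ => le_rfl⟩

lemma isDeterministic_stepProcess (τ : ℝ≥0) (N : ℕ) (f : ℝ → Mat n d) :
    (stepProcess F τ N f).IsDeterministic := ⟨_, fun _ _ => rfl⟩

lemma norm_stepProcess_eval_sub_le {τ : ℝ≥0} {N : ℕ} {f : ℝ → Mat n d} {η δ : ℝ}
    (hf : ∀ x y, |x - y| < δ → ‖f x - f y‖ ≤ η) (hN : τ / (N + 1) < δ) {r : ℝ}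
    (hr : r ∈ Set.Ioc (0 : ℝ) τ) (ω : Ω) :
    ‖(stepProcess F τ N f).eval r.toNNReal ω - f r‖ ≤ η := by
  have hmem : r.toNNReal ∈ Set.Ioc ((stepProcess F τ N f).time 0)
      ((stepProcess F τ N f).time (N + 1)) := by
    have h1 : (stepProcess F τ N f).time 0 = 0 := by simp [stepProcess]
    have h2 : (stepProcess F τ N f).time (N + 1) = τ := by
      simp only [stepProcess]
      push_cast
      rw [div_self (by positivity), one_mul]
    rw [h1, h2]
    exact ⟨by simpa using hr.1, Real.toNNReal_le_iff_le_coe.2 hr.2⟩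
  rw [← (stepProcess F τ N f).time_mono.biUnion_Ico_Ioc_map_succ 0 (N + 1)] at hmem
  obtain ⟨i, hi, hir⟩ := Set.mem_iUnion₂.1 hmem
  rw [(stepProcess F τ N f).eval_of_mem hi.2 hir]
  refine hf _ _ ?_
  have h1 : ((i / (N + 1) * τ : ℝ≥0) : ℝ) < r := by
    have := hir.1
    rwa [Real.lt_toNNReal_iff_coe_lt] at this
  have h2 : r ≤ (((i + 1 : ℕ) / (N + 1) * τ : ℝ≥0) : ℝ) := by
    have := hir.2
    rw [Order.succ_eq_add_one, Real.toNNReal_le_iff_le_coe] at this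
    exact this
  rw [abs_sub_comm, abs_of_pos (sub_pos.2 h1)]
  refine lt_of_le_of_lt ?_ hN
  push_cast at h2 ⊢
  have : ((i : ℝ) + 1) / (N + 1) * τ = i / (N + 1) * τ + τ / (N + 1) := by ring
  linarith

/-- Deterministic simple processes are dense in `L²([0, τ])`. -/
lemma exists_isDeterministic_lintegral_le {τ : ℝ≥0} {h : ℝ → Mat n d} (hh : MemDetL2 τ h) {ε : ℝ}
    (hε : 0 < ε) : ∃ S : SimpleProcess n d F, S.IsDeterministic ∧
      ∀ ω, ∫⁻ r in Set.Icc (0 : ℝ) τ, ‖S.eval r.toNNReal ω - h r‖ₑ ^ 2 ≤ ENNReal.ofReal ε := by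
  set h' : ℝ → Mat n d := (Set.Icc (0 : ℝ) τ).indicator h with hh'
  have hmem : MemLp h' 2 volume := by
    refine ⟨(measurable_indicator_Icc hh.measurable).aestronglyMeasurable, ?_⟩
    rw [hh', eLpNorm_indicator_eq_eLpNorm_restrict measurableSet_Icc,
      eLpNorm_lt_top_iff_lintegral_rpow_enorm_lt_top (by norm_num) (by norm_num)]
    simpa using hh.sq_integrable
  obtain ⟨f, hfs, hfε, hfc, -⟩ := hmem.exists_hasCompactSupport_eLpNorm_sub_le (by norm_num)
    (ε := ENNReal.ofReal √(ε / 4)) (by simpa using hε)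
  have hfu : UniformContinuous f := hfs.uniformContinuous_of_continuous hfc
  set η : ℝ := √(ε / (4 * (τ + 1))) with hη
  have hη0 : 0 < η := Real.sqrt_pos.2 (by positivity)
  obtain ⟨δ, hδ, hfδ⟩ := Metric.uniformContinuous_iff.1 hfu η hη0
  obtain ⟨N, hN⟩ : ∃ N : ℕ, (τ : ℝ) / (N + 1) < δ := by
    obtain ⟨N, hN⟩ := exists_nat_gt ((τ : ℝ) / δ)
    refine ⟨N, ?_⟩
    rw [div_lt_iff₀ hδ] at hN
    rw [div_lt_iff₀ (by positivity)]
    linarith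
  refine ⟨stepProcess F τ N f, isDeterministic_stepProcess τ N f, fun ω => ?_⟩
  have hstep : ∀ r ∈ Set.Ioc (0 : ℝ) τ,
      ‖(stepProcess F τ N f).eval r.toNNReal ω - f r‖ₑ ^ 2 ≤ ENNReal.ofReal (η ^ 2) := by
    intro r hr
    rw [← ofReal_norm, ← ENNReal.ofReal_pow (norm_nonneg _)]
    refine ENNReal.ofReal_le_ofReal (pow_le_pow_left₀ (norm_nonneg _) ?_ 2)
    refine norm_stepProcess_eval_sub_le (δ := δ) (fun x y hxy => ?_) hN hr ω
    rw [← dist_eq_norm]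
    exact (hfδ (by rwa [Real.dist_eq])).le
  have hdiff : ∫⁻ r in Set.Ioc (0 : ℝ) τ, ‖f r - h r‖ₑ ^ 2 ≤ ENNReal.ofReal (ε / 4) := by
    calc ∫⁻ r in Set.Ioc (0 : ℝ) τ, ‖f r - h r‖ₑ ^ 2
        = ∫⁻ r in Set.Ioc (0 : ℝ) τ, ‖(h' - f) r‖ₑ ^ 2 := by
          refine setLIntegral_congr_fun measurableSet_Ioc fun r hr => ?_
          simp only [hh', Pi.sub_apply, Set.indicator_of_mem (Set.Ioc_subset_Icc_self hr)]
          rw [← enorm_neg, neg_sub]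
      _ ≤ ∫⁻ r, ‖(h' - f) r‖ₑ ^ 2 := setLIntegral_le_lintegral _ _
      _ = eLpNorm (h' - f) 2 volume ^ 2 := by
          have := eLpNorm_nnreal_pow_eq_lintegral (f := h' - f) (μ := volume) (p := 2) (by norm_num)
          simpa using this.symm
      _ ≤ ENNReal.ofReal √(ε / 4) ^ 2 := by gcongr
      _ = ENNReal.ofReal (ε / 4) := by
          rw [← ENNReal.ofReal_pow (Real.sqrt_nonneg _), Real.sq_sqrt (by positivity)]
  have hfm : AEMeasurable (fun r => ‖f r - h r‖ₑ ^ 2) (volume.restrict (Set.Ioc (0 : ℝ) τ)) :=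
    ((hfc.measurable.aemeasurable.sub (aemeasurable_restrict_Icc hh.measurable)).enorm.pow_const
      2).mono_measure (Measure.restrict_mono Set.Ioc_subset_Icc_self le_rfl)
  rw [setLIntegral_congr Ioc_ae_eq_Icc.symm]
  calc ∫⁻ r in Set.Ioc (0 : ℝ) τ, ‖(stepProcess F τ N f).eval r.toNNReal ω - h r‖ₑ ^ 2
      ≤ ∫⁻ r in Set.Ioc (0 : ℝ) τ, (2 * ENNReal.ofReal (η ^ 2) + 2 * ‖f r - h r‖ₑ ^ 2) := by
        refine setLIntegral_mono' measurableSet_Ioc fun r hr => ?_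
        refine (enorm_sq_le_two_mul _ (f r - h r)).trans ?_
        rw [sub_sub_sub_cancel_right]
        gcongr
        exact hstep r hr
    _ = 2 * ENNReal.ofReal (η ^ 2) * ENNReal.ofReal τ +
          2 * ∫⁻ r in Set.Ioc (0 : ℝ) τ, ‖f r - h r‖ₑ ^ 2 := by
        rw [lintegral_add_right' _ (hfm.const_mul 2), lintegral_const,
          lintegral_const_mul' _ _ (by norm_num), Measure.restrict_apply_univ, Real.volume_Ioc, sub_zero]
    _ ≤ ENNReal.ofReal (ε / 2) + 2 * ENNReal.ofReal (ε / 4) := by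
        gcongr
        rw [← ENNReal.ofReal_ofNat 2, ← ENNReal.ofReal_mul (by norm_num),
          ← ENNReal.ofReal_mul (by positivity)]
        refine ENNReal.ofReal_le_ofReal ?_
        rw [hη, Real.sq_sqrt (by positivity)]
        have : 2 * (ε / (4 * (τ + 1))) * τ = ε / 2 * (τ / (τ + 1)) := by
          field_simp
          ring
        rw [this]
        refine mul_le_of_le_one_right (by positivity) ?_
        exact div_le_one_of_le₀ (by linarith) (by positivity)
    _ = ENNReal.ofReal ε := by
        rw [← ENNReal.ofReal_ofNat 2, ← ENNReal.ofReal_mul (by norm_num),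
          ← ENNReal.ofReal_add (by positivity) (by positivity)]
        congr 1
        ring

end Approximation

/-! ### Existence of the Itô integral of a deterministic integrand -/

namespace SimpleProcess

variable {Ω : Type*} [mΩ : MeasurableSpace Ω] {F : Filtration ℝ≥0 mΩ} {n d : ℕ}
  {B : ℝ≥0 → Ω → Vec d}

lemma continuous_integral (S : SimpleProcess n d F) {ω : Ω}
    (hω : ∀ j, Continuous fun t => B t ω j) : Continuous fun s => S.integral B s ω := by
  have h : Continuous fun s => WithLp.ofLp (S.integral B s ω) := by
    refine continuous_pi fun a => ?_
    simp only [integral_apply]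
    refine continuous_finsetSum _ fun j _ => continuous_finsetSum _ fun i _ => ?_
    exact continuous_const.mul (((hω j).comp (continuous_const.min continuous_id)).sub
      ((hω j).comp (continuous_const.min continuous_id)))
  exact (PiLp.continuous_toLp 2 _).comp h

lemma measurable_eval (S : SimpleProcess n d F) (ω : Ω) :
    Measurable fun r : ℝ => S.eval r.toNNReal ω := by
  refine Finset.measurable_fun_sum _ fun i _ => ?_
  exact (measurable_const.indicator measurableSet_Ioc).comp measurable_real_toNNReal

lemma sum_indicator_min_eq {S : SimpleProcess n d F} (τ : ℝ≥0) (r : ℝ) (ω : Ω)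
    (p : Fin n × Fin d) :
    ∑ i ∈ Finset.range S.steps, S.value i ω p *
      (Set.Ioc ((min (S.time i) τ : ℝ≥0) : ℝ) (min (S.time (i + 1)) τ : ℝ≥0)).indicator 1 r =
    (Set.Ioc (0 : ℝ) τ).indicator (fun r => S.eval r.toNNReal ω p) r := by
  by_cases hr : r ∈ Set.Ioc (0 : ℝ) τ
  · rw [Set.indicator_of_mem hr, SimpleProcess.eval, WithLp.ofLp_sum, Finset.sum_apply]
    refine Finset.sum_congr rfl fun i _ => ?_
    have hiff : r ∈ Set.Ioc ((min (S.time i) τ : ℝ≥0) : ℝ) (min (S.time (i + 1)) τ : ℝ≥0) ↔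
        r.toNNReal ∈ Set.Ioc (S.time i) (S.time (i + 1)) := by
      simp only [Set.mem_Ioc, NNReal.coe_min, le_min_iff, min_lt_iff, Real.lt_toNNReal_iff_coe_lt,
        Real.toNNReal_le_iff_le_coe, hr.2, and_true, not_lt.2 hr.2, or_false]
    by_cases hi : r.toNNReal ∈ Set.Ioc (S.time i) (S.time (i + 1))
    · rw [Set.indicator_of_mem hi, Set.indicator_of_mem (hiff.2 hi), Pi.one_apply, mul_one]
    · rw [Set.indicator_of_notMem hi, Set.indicator_of_notMem (fun h => hi (hiff.1 h)), mul_zero]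
      rfl
  · rw [Set.indicator_of_notMem hr]
    refine Finset.sum_eq_zero fun i _ => ?_
    rw [Set.indicator_of_notMem, mul_zero]
    refine fun h => hr ⟨lt_of_le_of_lt (NNReal.coe_nonneg _) h.1, h.2.trans ?_⟩
    exact_mod_cast min_le_right _ _

variable {P : Measure Ω} [IsProbabilityMeasure P]

lemma IsDeterministic.martingale {S : SimpleProcess n d F} (hS : S.IsDeterministic)
    (hB : ∀ j, IsFilteredBrownian (fun t ω => B t ω j) F P) (a : Fin n) :
    Martingale (fun s ω => S.integral B s ω a) F P := by
  obtain ⟨c, hc⟩ := hS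
  have heq : (fun s ω => S.integral B s ω a) = ∑ j, ∑ i ∈ Finset.range S.steps,
      c i (a, j) • ((fun s ω => B (min (S.time (i + 1)) s) ω j) -
        fun s ω => B (min (S.time i) s) ω j) := by
    ext s ω
    simp [integral_apply, hc, Finset.sum_apply]
  rw [heq]
  refine Finset.sum_induction _ (fun f => Martingale f F P) (fun _ _ hf hg => hf.add hg)
    (martingale_zero ..) fun j _ => ?_
  refine Finset.sum_induction _ (fun f => Martingale f F P) (fun _ _ hf hg => hf.add hg)
    (martingale_zero ..) fun i _ => ?_
  exact (((hB j).martingale_min _).sub ((hB j).martingale_min _)).smul _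

lemma IsDeterministic.measurable_integral {S : SimpleProcess n d F} (hS : S.IsDeterministic)
    (hB : ∀ j, IsFilteredBrownian (fun t ω => B t ω j) F P) (s : ℝ≥0) :
    Measurable[F s] (S.integral B s) := by
  have hlp : Measurable (WithLp.toLp 2 : (Fin n → ℝ) → Vec n) :=
    (PiLp.continuous_toLp 2 _).measurable
  exact hlp.comp (@measurable_pi_lambda _ _ _ (F s) _ _ fun a =>
    ((hS.martingale hB a).stronglyMeasurable s).measurable)

/-- The second moment bound for the difference of the integrals of two deterministic simple
processes, which need not be subordinate to a common partition. -/
lemma IsDeterministic.integral_norm_sub_sq_le {S S' : SimpleProcess n d F}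
    (hS : S.IsDeterministic) (hS' : S'.IsDeterministic)
    (hB : ∀ j, IsFilteredBrownian (fun t ω => B t ω j) F P) {τ : ℝ≥0} {C : ℝ} (hC : 0 ≤ C)
    (hle : ∀ ω, ∫⁻ r in Set.Icc (0 : ℝ) τ,
      ‖S.eval r.toNNReal ω - S'.eval r.toNNReal ω‖ₑ ^ 2 ≤ ENNReal.ofReal C) :
    ∫ ω, ‖S.integral B τ ω - S'.integral B τ ω‖ ^ 2 ∂P ≤ d * C := by
  obtain ⟨c, hc⟩ := hS
  obtain ⟨c', hc'⟩ := hS'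
  obtain ⟨ω₀⟩ : Nonempty Ω := nonempty_of_isProbabilityMeasure P
  set I : Finset (ℕ ⊕ ℕ) := (Finset.range S.steps).disjSum (Finset.range S'.steps) with hI
  set co : Fin n → Fin d → ℕ ⊕ ℕ → ℝ := fun a j =>
    Sum.elim (fun i => c i (a, j)) (fun i => -c' i (a, j)) with hco
  set lo : ℕ ⊕ ℕ → ℝ≥0 := Sum.elim (fun i => min (S.time i) τ) (fun i => min (S'.time i) τ) with hlo
  set hi : ℕ ⊕ ℕ → ℝ≥0 :=
    Sum.elim (fun i => min (S.time (i + 1)) τ) (fun i => min (S'.time (i + 1)) τ) with hhi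
  have hlohi : ∀ i, lo i ≤ hi i := by
    rintro (i | i)
    · exact min_le_min_right _ (S.time_mono (Nat.le_succ i))
    · exact min_le_min_right _ (S'.time_mono (Nat.le_succ i))
  set X : Fin n → Fin d → Ω → ℝ := fun a j ω =>
    ∑ i ∈ I, co a j i * (B (hi i) ω j - B (lo i) ω j) with hX
  have hXmem : ∀ a j, MemLp (X a j) 2 P := fun a j => memLp_finsetSum _ fun i _ =>
    (((hB j).memLp _).sub ((hB j).memLp _)).const_mul _
  have hdiff : ∀ ω a, (S.integral B τ ω - S'.integral B τ ω) a = ∑ j, X a j ω := by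
    intro ω a
    rw [PiLp.sub_apply, integral_apply, integral_apply, ← Finset.sum_sub_distrib]
    refine Finset.sum_congr rfl fun j _ => ?_
    simp only [hX, hI, Finset.sum_disjSum, hco, hlo, hhi, Sum.elim_inl, Sum.elim_inr, neg_mul,
      Finset.sum_neg_distrib, hc, hc', sub_eq_add_neg]
  set D : ℝ → Mat n d := fun r => S.eval r.toNNReal ω₀ - S'.eval r.toNNReal ω₀ with hD
  have hXsq : ∀ a j, ∫ ω, X a j ω ^ 2 ∂P =
      ∫ r, (Set.Ioc (0 : ℝ) τ).indicator (fun r => D r (a, j) ^ 2) r := by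
    intro a j
    rw [hX, (hB j).integral_sq_sum_deterministic I (co a j) hlohi]
    congr 1
    ext r
    have h1 := S.sum_indicator_min_eq τ r ω₀ (a, j)
    have h2 := S'.sum_indicator_min_eq τ r ω₀ (a, j)
    simp only [hc, hc'] at h1 h2
    simp only [hI, Finset.sum_disjSum, hco, hlo, hhi, Sum.elim_inl, Sum.elim_inr, neg_mul,
      Finset.sum_neg_distrib]
    rw [h1, h2]
    by_cases hr : r ∈ Set.Ioc (0 : ℝ) τ
    · simp [Set.indicator_of_mem hr, hD, sub_eq_add_neg]
    · simp [Set.indicator_of_notMem hr]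
  have hDm : Measurable D := (S.measurable_eval ω₀).sub (S'.measurable_eval ω₀)
  have hDb : ∃ K : ℝ, ∀ r, ‖D r‖ ≤ K := by
    have hb : ∀ S : SimpleProcess n d F, ∃ K : ℝ, ∀ r : ℝ, ‖S.eval r.toNNReal ω₀‖ ≤ K := by
      intro S
      refine ⟨∑ i ∈ Finset.range S.steps, ‖S.value i ω₀‖, fun r => ?_⟩
      exact norm_sum_le_of_le _ fun i _ => norm_indicator_le_norm_self _ _
    obtain ⟨K, hK⟩ := hb S
    obtain ⟨K', hK'⟩ := hb S'
    exact ⟨K + K', fun r => (norm_sub_le _ _).trans (add_le_add (hK r) (hK' r))⟩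
  obtain ⟨K, hK⟩ := hDb
  have hDi : ∀ p, IntegrableOn (fun r => D r p ^ 2) (Set.Ioc (0 : ℝ) τ) := by
    intro p
    refine Measure.integrableOn_of_bounded (M := K ^ 2) measure_Ioc_lt_top.ne
      (((EuclideanSpace.proj (𝕜 := ℝ) p).continuous.measurable.comp hDm).pow_const
        2).aestronglyMeasurable (ae_of_all _ fun r => ?_)
    rw [norm_pow]
    exact pow_le_pow_left₀ (norm_nonneg _) ((PiLp.norm_apply_le _ p).trans (hK r)) 2
  calc ∫ ω, ‖S.integral B τ ω - S'.integral B τ ω‖ ^ 2 ∂P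
      ≤ ∫ ω, ∑ a, d * ∑ j, X a j ω ^ 2 ∂P := by
        refine integral_mono ((S.memLp_integral hB τ).sub
          (S'.memLp_integral hB τ)).norm.integrable_sq
          (integrable_finsetSum _ fun a _ => (integrable_finsetSum _ fun j _ =>
            (hXmem a j).integrable_sq).const_mul _) fun ω => ?_
        simp only [EuclideanSpace.norm_sq_eq, Real.norm_eq_abs, sq_abs, hdiff]
        refine Finset.sum_le_sum fun a _ => ?_
        refine sq_sum_le_card_mul_sum_sq.trans (le_of_eq ?_)
        rw [Finset.card_univ, Fintype.card_fin]
    _ = d * ∑ a, ∑ j, ∫ r in Set.Ioc (0 : ℝ) τ, D r (a, j) ^ 2 := by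
        rw [integral_finsetSum _ fun a _ => (integrable_finsetSum _ fun j _ =>
            (hXmem a j).integrable_sq).const_mul _, Finset.mul_sum]
        refine Finset.sum_congr rfl fun a _ => ?_
        rw [integral_const_mul, integral_finsetSum _ fun j _ => (hXmem a j).integrable_sq]
        simp only [hXsq, integral_indicator measurableSet_Ioc]
    _ = d * ∫ r in Set.Ioc (0 : ℝ) τ, ‖D r‖ ^ 2 := by
        simp only [EuclideanSpace.norm_sq_eq, Real.norm_eq_abs, sq_abs]
        rw [integral_finsetSum _ fun p _ => hDi p, Fintype.sum_prod_type]
    _ ≤ d * C := by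
        gcongr
        rw [integral_eq_lintegral_of_nonneg_ae (ae_of_all _ fun r => by positivity)
          (hDm.norm.pow_const 2).aestronglyMeasurable]
        refine ENNReal.toReal_le_of_le_ofReal hC ?_
        refine le_trans (le_of_eq ?_) (hle ω₀)
        rw [setLIntegral_congr Ioc_ae_eq_Icc]
        simp only [ENNReal.ofReal_pow (norm_nonneg _), ofReal_norm, hD]

/-- The maximal inequality for the difference of the integrals of two deterministic simple
processes. -/
lemma IsDeterministic.measure_exists_lt_abs_sub_le {S S' : SimpleProcess n d F}
    (hS : S.IsDeterministic) (hS' : S'.IsDeterministic)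
    (hB : ∀ j, IsFilteredBrownian (fun t ω => B t ω j) F P)
    (hcont : ∀ᵐ ω ∂P, ∀ j, Continuous fun t => B t ω j) {τ : ℝ≥0} {C : ℝ} (hC : 0 ≤ C)
    (hle : ∀ ω, ∫⁻ r in Set.Icc (0 : ℝ) τ,
      ‖S.eval r.toNNReal ω - S'.eval r.toNNReal ω‖ₑ ^ 2 ≤ ENNReal.ofReal C) (a : Fin n) {c : ℝ}
    (hc : 0 < c) :
    P {ω | ∃ s ≤ τ, c < |S.integral B s ω a - S'.integral B s ω a|} ≤
      ENNReal.ofReal (√(d * C) / c) := by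
  have hmart := (hS.martingale hB a).sub (hS'.martingale hB a)
  refine (measure_exists_lt_abs_le hmart ?_ τ hc).trans (ENNReal.ofReal_le_ofReal ?_)
  · filter_upwards [hcont] with ω hω
    exact ((PiLp.continuous_apply 2 _ a).comp (S.continuous_integral hω)).sub
      ((PiLp.continuous_apply 2 _ a).comp (S'.continuous_integral hω))
  gcongr
  have hmem : MemLp (fun ω => S.integral B τ ω - S'.integral B τ ω) 2 P :=
    (S.memLp_integral hB τ).sub (S'.memLp_integral hB τ)
  refine Real.le_sqrt_of_sq_le ?_
  have hnorm : ∫ ω, |S.integral B τ ω a - S'.integral B τ ω a| ∂P ≤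
      ∫ ω, ‖S.integral B τ ω - S'.integral B τ ω‖ ∂P := by
    refine integral_mono_of_nonneg (ae_of_all _ fun ω => abs_nonneg _)
      (hmem.integrable (by norm_num)).norm (ae_of_all _ fun ω => ?_)
    exact PiLp.norm_apply_le (S.integral B τ ω - S'.integral B τ ω) a
  -- the variance of the norm is nonnegative
  have hvar := variance_nonneg (fun ω => ‖S.integral B τ ω - S'.integral B τ ω‖) P
  rw [variance_eq_sub hmem.norm] at hvar
  simp only [Pi.pow_apply] at hvar
  calc (∫ ω, |S.integral B τ ω a - S'.integral B τ ω a| ∂P) ^ 2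
      ≤ (∫ ω, ‖S.integral B τ ω - S'.integral B τ ω‖ ∂P) ^ 2 :=
        pow_le_pow_left₀ (integral_nonneg fun ω => abs_nonneg _) hnorm 2
    _ ≤ ∫ ω, ‖S.integral B τ ω - S'.integral B τ ω‖ ^ 2 ∂P := by linarith
    _ ≤ d * C := hS.integral_norm_sub_sq_le hS' hB hC hle

end SimpleProcess

section Existence

variable {Ω : Type*} [mΩ : MeasurableSpace Ω] {F : Filtration ℝ≥0 mΩ} {n d : ℕ}
  {P : Measure Ω} {B : ℝ≥0 → Ω → Vec d} {τ : ℝ≥0} {h : ℝ → Mat n d}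

lemma memH2_of_memDetL2 (hh : MemDetL2 τ h) : MemH2 P F τ (fun s (_ : Ω) => h s) where
  predictable := isPredictableUpTo_of_measurable_Icc hh.measurable
  sq_integrable := by
    refine ae_of_all _ fun ω => ?_
    refine lt_of_le_of_lt (le_of_eq ?_) hh.sq_integrable
    refine setLIntegral_congr_fun measurableSet_Icc fun r hr => ?_
    simp only [Real.coe_toNNReal r hr.1]

lemma lintegral_sub_le_of_approx (hh : MemDetL2 τ h) {S S' : SimpleProcess n d F} {ε ε' : ℝ}
    (hε : 0 ≤ ε) (hε' : 0 ≤ ε') {ω : Ω}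
    (hS : ∫⁻ r in Set.Icc (0 : ℝ) τ, ‖S.eval r.toNNReal ω - h r‖ₑ ^ 2 ≤ ENNReal.ofReal ε)
    (hS' : ∫⁻ r in Set.Icc (0 : ℝ) τ, ‖S'.eval r.toNNReal ω - h r‖ₑ ^ 2 ≤ ENNReal.ofReal ε') :
    ∫⁻ r in Set.Icc (0 : ℝ) τ, ‖S.eval r.toNNReal ω - S'.eval r.toNNReal ω‖ₑ ^ 2 ≤
      ENNReal.ofReal (2 * ε + 2 * ε') := by
  have hm : AEMeasurable (fun r : ℝ => ‖S'.eval r.toNNReal ω - h r‖ₑ ^ 2)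
      (volume.restrict (Set.Icc (0 : ℝ) τ)) :=
    ((S'.measurable_eval ω).aemeasurable.sub
      (aemeasurable_restrict_Icc hh.measurable)).enorm.pow_const 2
  calc ∫⁻ r in Set.Icc (0 : ℝ) τ, ‖S.eval r.toNNReal ω - S'.eval r.toNNReal ω‖ₑ ^ 2
      ≤ ∫⁻ r in Set.Icc (0 : ℝ) τ, (2 * ‖S.eval r.toNNReal ω - h r‖ₑ ^ 2 +
          2 * ‖S'.eval r.toNNReal ω - h r‖ₑ ^ 2) := by
        refine lintegral_mono fun r => ?_
        have := enorm_sq_le_two_mul (S.eval r.toNNReal ω - S'.eval r.toNNReal ω)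
          (h r - S'.eval r.toNNReal ω)
        rwa [sub_sub_sub_cancel_right, ← enorm_neg (h r - _), neg_sub] at this
    _ = 2 * (∫⁻ r in Set.Icc (0 : ℝ) τ, ‖S.eval r.toNNReal ω - h r‖ₑ ^ 2) +
          2 * ∫⁻ r in Set.Icc (0 : ℝ) τ, ‖S'.eval r.toNNReal ω - h r‖ₑ ^ 2 := by
        rw [lintegral_add_right' _ (hm.const_mul 2), lintegral_const_mul' _ _ (by norm_num),
          lintegral_const_mul' _ _ (by norm_num)]
    _ ≤ 2 * ENNReal.ofReal ε + 2 * ENNReal.ofReal ε' := by gcongr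
    _ = _ := by
        rw [ENNReal.ofReal_add (by positivity) (by positivity), ENNReal.ofReal_mul (by norm_num),
          ENNReal.ofReal_mul (by norm_num), ENNReal.ofReal_ofNat]

/-- If the oscillation between consecutive terms of a sequence of paths is eventually dominated
by `2⁻ᵏ` on `[0, τ]`, then the paths converge uniformly on `[0, τ]`. -/
lemma exists_tendstoUniformlyOn {x : ℕ → ℝ≥0 → Vec n}
    (hx : ∀ᶠ k in atTop, ∀ s ≤ τ, ∀ a, |x k s a - x (k + 1) s a| ≤ (1 / 2) ^ k) :
    ∃ y : ℝ≥0 → Vec n, TendstoUniformlyOn x y atTop (Set.Iic τ) := by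
  obtain ⟨K, hK⟩ := eventually_atTop.1 hx
  have hdist : ∀ k ≥ K, ∀ s ≤ τ, dist (x k s) (x (k + 1) s) ≤ √n * (1 / 2) ^ k := by
    intro k hk s hs
    rw [EuclideanSpace.dist_eq]
    have hsum : ∑ a, dist (x k s a) (x (k + 1) s a) ^ 2 ≤ n * ((1 / 2) ^ k) ^ 2 := by
      calc ∑ a, dist (x k s a) (x (k + 1) s a) ^ 2 ≤ ∑ _ : Fin n, ((1 / 2 : ℝ) ^ k) ^ 2 :=
            Finset.sum_le_sum fun a _ => pow_le_pow_left₀ dist_nonneg (hK k hk s hs a) 2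
        _ = _ := by simp
    refine (Real.sqrt_le_sqrt hsum).trans (le_of_eq ?_)
    rw [Real.sqrt_mul (by positivity), Real.sqrt_sq (by positivity)]
  have hgeo : ∀ s ≤ τ, ∀ k, dist (x (k + K) s) (x (k + 1 + K) s) ≤
      (√n * (1 / 2) ^ K) * (1 / 2) ^ k := by
    intro s hs k
    have := hdist (k + K) (by omega) s hs
    rw [show k + 1 + K = k + K + 1 by ring]
    refine this.trans (le_of_eq ?_)
    rw [pow_add]
    ring
  have hlim : ∀ s, ∃ y, s ≤ τ → Tendsto (fun k => x (k + K) s) atTop (𝓝 y) := by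
    intro s
    by_cases hs : s ≤ τ
    · obtain ⟨y, hy⟩ := cauchySeq_tendsto_of_complete
        (cauchySeq_of_le_geometric _ _ (by norm_num) (hgeo s hs))
      exact ⟨y, fun _ => hy⟩
    · exact ⟨0, fun h => absurd h hs⟩
  choose y hy using hlim
  refine ⟨y, ?_⟩
  rw [Metric.tendstoUniformlyOn_iff]
  intro ε hε
  have h0 : Tendsto (fun k : ℕ => √n * (1 / 2) ^ K * (1 / 2 : ℝ) ^ k / (1 - 1 / 2)) atTop (𝓝 0) := by
    have := (tendsto_pow_atTop_nhds_zero_of_lt_one (r := (1 / 2 : ℝ)) (by norm_num)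
      (by norm_num)).const_mul (√n * (1 / 2) ^ K)
    simpa using this.div_const (1 - 1 / 2)
  obtain ⟨L, hL⟩ := eventually_atTop.1 (h0.eventually (gt_mem_nhds hε))
  refine eventually_atTop.2 ⟨L + K, fun k hk s hs => ?_⟩
  obtain ⟨m, rfl⟩ : ∃ m, k = m + K := ⟨k - K, by omega⟩
  rw [dist_comm]
  exact (dist_le_of_le_geometric_of_tendsto _ _ (by norm_num) (hgeo s hs) (hy s hs) m).trans_lt
    (hL m (by omega))

variable [IsProbabilityMeasure P]

/-- The Itô integral of a deterministic square integrable function exists as a continuous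
predictable process. -/
lemma exists_isItoIntegral (hF : ∀ N, P N = 0 → MeasurableSet[F 0] N)
    (hB : ∀ j, IsFilteredBrownian (fun t ω => B t ω j) F P)
    (hcont : ∀ᵐ ω ∂P, ∀ j, Continuous fun t => B t ω j) (hh : MemDetL2 τ h) :
    ∃ M, IsItoIntegral P F B τ (fun s _ => h s) M := by
  -- the errors `16⁻ᵏ` make the right-hand sides of the maximal inequalities at level `2⁻ᵏ` summable
  choose S hSdet hS using fun k : ℕ =>
    exists_isDeterministic_lintegral_le (F := F) hh (ε := (1 / 16 : ℝ) ^ k) (by positivity)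
  have hdiff : ∀ k ω, ∫⁻ r in Set.Icc (0 : ℝ) τ,
      ‖(S k).eval r.toNNReal ω - (S (k + 1)).eval r.toNNReal ω‖ₑ ^ 2 ≤
        ENNReal.ofReal (4 * (1 / 16) ^ k) := by
    intro k ω
    refine (lintegral_sub_le_of_approx hh (by positivity) (by positivity) (hS k ω)
      (hS (k + 1) ω)).trans (ENNReal.ofReal_le_ofReal ?_)
    have : (0 : ℝ) ≤ (1 / 16) ^ k := by positivity
    rw [pow_succ]
    linarith
  have hprob : ∀ a k, P {ω | ∃ s ≤ τ,
      (1 / 2) ^ k < |(S k).integral B s ω a - (S (k + 1)).integral B s ω a|} ≤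
      ENNReal.ofReal (2 * √d) * (ENNReal.ofReal (1 / 2)) ^ k := by
    intro a k
    refine ((hSdet k).measure_exists_lt_abs_sub_le (hSdet (k + 1)) hB hcont (by positivity)
      (hdiff k) a (by positivity)).trans (le_of_eq ?_)
    rw [← ENNReal.ofReal_pow (by norm_num), ← ENNReal.ofReal_mul (by positivity)]
    congr 1
    have h1 : (d : ℝ) * (4 * (1 / 16) ^ k) = d * (2 * (1 / 4) ^ k) ^ 2 := by
      rw [mul_pow, ← pow_mul, mul_comm k 2, pow_mul]
      norm_num
    have h2 : (1 / 4 : ℝ) ^ k = (1 / 2) ^ k * (1 / 2) ^ k := by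
      rw [← mul_pow]
      norm_num
    rw [h1, Real.sqrt_mul (by positivity), Real.sqrt_sq (by positivity), h2]
    field_simp
  set G : Set Ω := {ω | (∀ j, Continuous fun t => B t ω j) ∧ ∀ᶠ k in atTop, ∀ s ≤ τ, ∀ a,
    |(S k).integral B s ω a - (S (k + 1)).integral B s ω a| ≤ (1 / 2) ^ k} with hGdef
  have hGae : ∀ᵐ ω ∂P, ω ∈ G := by
    have hbc : ∀ a, ∀ᵐ ω ∂P, ∀ᶠ k in atTop, ω ∉ {ω | ∃ s ≤ τ,
        (1 / 2) ^ k < |(S k).integral B s ω a - (S (k + 1)).integral B s ω a|} := by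
      intro a
      refine ae_eventually_notMem (ne_top_of_le_ne_top ?_ (ENNReal.tsum_le_tsum (hprob a)))
      rw [ENNReal.tsum_mul_left, ENNReal.tsum_geometric]
      refine ENNReal.mul_ne_top ENNReal.ofReal_ne_top (ENNReal.inv_ne_top.2 ?_)
      rw [← ENNReal.ofReal_one, ← ENNReal.ofReal_sub _ (by norm_num)]
      norm_num
    filter_upwards [hcont, ae_all_iff.2 hbc] with ω h1 h2
    refine ⟨h1, ?_⟩
    filter_upwards [eventually_all.2 h2] with k hk s hs a
    by_contra hlt
    exact hk a ⟨s, hs, not_le.1 hlt⟩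
  have hGm : MeasurableSet[F 0] G := by
    have := (hF Gᶜ hGae).compl
    rwa [compl_compl] at this
  have hchoice : ∀ ω, ∃ y : ℝ≥0 → Vec n, (ω ∈ G → TendstoUniformlyOn
      (fun k s => (S k).integral B s ω) y atTop (Set.Iic τ)) ∧ (ω ∉ G → y = 0) := by
    intro ω
    by_cases hω : ω ∈ G
    · obtain ⟨y, hy⟩ := exists_tendstoUniformlyOn hω.2
      exact ⟨y, fun _ => hy, fun h => absurd hω h⟩
    · exact ⟨0, fun h => absurd h hω, fun _ => rfl⟩
  choose y hyG hyG' using hchoice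
  refine ⟨fun s ω => y ω s, memH2_of_memDetL2 hh, ⟨?_, ?_⟩, S, fun δ hδ => ?_, fun s hs => ?_⟩
  · -- predictability: a pointwise limit of continuous adapted processes
    set u : ℕ → ℝ≥0 → Ω → Vec n := fun k s => G.indicator ((S k).integral B s) with hu
    have hupred : ∀ k, IsPredictableUpTo F τ (u k) := by
      intro k
      refine isPredictableUpTo_of_isStronglyPredictable
        (isStronglyPredictable_of_continuous (fun t => ?_) fun ω => ?_) τ
      · exact ((hSdet k).measurable_integral hB t).indicator (F.mono zero_le _ hGm)
      · by_cases hω : ω ∈ G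
        · simpa only [hu, Set.indicator_of_mem hω] using (S k).continuous_integral hω.1
        · simpa only [hu, Set.indicator_of_notMem hω] using continuous_const
    let : MeasurableSpace (ℝ≥0 × Ω) := F.predictable
    refine stronglyMeasurable_of_tendsto (f := fun k => Function.uncurry ((Set.Iic τ).indicator
      (u k))) atTop (fun k => hupred k) ?_
    rw [tendsto_pi_nhds]
    rintro ⟨s, ω⟩
    by_cases hs : s ∈ Set.Iic τ
    · simp only [Function.uncurry, Set.indicator_of_mem hs]
      by_cases hω : ω ∈ G
      · simpa only [hu, Set.indicator_of_mem hω] using (hyG ω hω).tendsto_at hs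
      · simp [hu, Set.indicator_of_notMem hω, hyG' ω hω]
    · simp [Function.uncurry, Set.indicator_of_notMem hs]
  · filter_upwards [hGae] with ω hω
    exact (hyG ω hω).continuousOn (Frequently.of_forall fun k =>
      ((S k).continuous_integral hω.1).continuousOn)
  · refine tendsto_const_nhds.congr' ?_
    have h0 : Tendsto (fun k : ℕ => ENNReal.ofReal ((1 / 16 : ℝ) ^ k)) atTop (𝓝 0) := by
      have := (ENNReal.continuous_ofReal.tendsto 0).comp
        (tendsto_pow_atTop_nhds_zero_of_lt_one (r := (1 / 16 : ℝ)) (by norm_num) (by norm_num))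
      rwa [ENNReal.ofReal_zero] at this
    filter_upwards [h0.eventually (gt_mem_nhds hδ)] with k hk
    have hempty : {ω | δ ≤ ∫⁻ r in Set.Icc (0 : ℝ) τ,
        ‖(S k).eval r.toNNReal ω - h r.toNNReal‖ₑ ^ 2} = ∅ := by
      refine Set.eq_empty_of_forall_notMem fun ω hω => ?_
      have heq : ∫⁻ r in Set.Icc (0 : ℝ) τ, ‖(S k).eval r.toNNReal ω - h r.toNNReal‖ₑ ^ 2 =
          ∫⁻ r in Set.Icc (0 : ℝ) τ, ‖(S k).eval r.toNNReal ω - h r‖ₑ ^ 2 := by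
        refine setLIntegral_congr_fun measurableSet_Icc fun r hr => ?_
        simp only [Real.coe_toNNReal r hr.1]
      rw [Set.mem_ofPred_eq, heq] at hω
      exact absurd (hω.trans (hS k ω)) (not_le.2 hk)
    rw [hempty, measure_empty]
  · refine tendstoInMeasure_of_tendsto_ae (fun k => ((S k).memLp_integral hB s).1) ?_
    filter_upwards [hGae] with ω hω
    exact (hyG ω hω).tendsto_at hs

end Existence

/-! ### Backward differential equations with a measurable Lipschitz right-hand side -/

section BackwardODE

variable {E : Type*} [NormedAddCommGroup E] {f : ℝ → E → E} {τ μ : ℝ}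

/-- The function `f` is an admissible right-hand side of a differential equation on `[0, τ]`: it is
measurable along continuous paths, integrable at the origin, and Lipschitz in the space variable
with constant `μ` at almost every time. -/
structure IsLipschitzRHS (f : ℝ → E → E) (τ μ : ℝ) : Prop where
  measurable : ∀ φ : ℝ → E, ContinuousOn φ (Set.Icc 0 τ) →
    AEStronglyMeasurable (fun r => f r (φ r)) (volume.restrict (Set.Icc 0 τ))
  integrable_zero : IntegrableOn (fun r => f r 0) (Set.Icc 0 τ)
  lipschitz : ∀ᵐ r ∂(volume.restrict (Set.Icc 0 τ)), ∀ x y, ‖f r x - f r y‖ ≤ μ * ‖x - y‖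

lemma IsLipschitzRHS.integrableOn (hf : IsLipschitzRHS f τ μ) {φ : ℝ → E}
    (hφ : ContinuousOn φ (Set.Icc 0 τ)) : IntegrableOn (fun r => f r (φ r)) (Set.Icc 0 τ) := by
  have hφi : IntegrableOn (fun r => μ * ‖φ r‖) (Set.Icc 0 τ) :=
    ((hφ.norm).integrableOn_compact isCompact_Icc).const_mul μ
  refine (hf.integrable_zero.norm.add hφi).mono' (hf.measurable φ hφ) ?_
  filter_upwards [hf.lipschitz] with r hr
  have h1 := hr (φ r) 0
  have h2 := norm_add_le (f r 0) (f r (φ r) - f r 0)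
  rw [add_sub_cancel] at h2
  rw [sub_zero] at h1
  exact h2.trans (by simpa using h1)

lemma IsLipschitzRHS.intervalIntegrable (hf : IsLipschitzRHS f τ μ) (hτ : 0 ≤ τ) {φ : ℝ → E}
    (hφ : ContinuousOn φ (Set.Icc 0 τ)) {s : ℝ} (hs : s ∈ Set.Icc 0 τ) :
    IntervalIntegrable (fun r => f r (φ r)) volume s τ := by
  have h : IntervalIntegrable (fun r => f r (φ r)) volume 0 τ := by
    rw [intervalIntegrable_iff_integrableOn_Icc_of_le hτ]
    exact hf.integrableOn hφ
  refine h.mono_set ?_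
  rw [Set.uIcc_of_le hs.2, Set.uIcc_of_le hτ]
  exact Set.Icc_subset_Icc_left hs.1

lemma continuous_extend (hτ : 0 ≤ τ) (u : C(Set.Icc 0 τ, E)) :
    Continuous fun r => u (Set.projIcc 0 τ hτ r) :=
  u.continuous.comp continuous_projIcc

variable [NormedSpace ℝ E]

/-- The Picard operator of the backward equation `φ(s) = y + ∫_s^τ f(r, φ(r)) dr`. -/
noncomputable def picardMap (hf : IsLipschitzRHS f τ μ) (hτ : 0 ≤ τ) (y : E)
    (u : C(Set.Icc 0 τ, E)) : C(Set.Icc 0 τ, E) where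
  toFun s := y + ∫ r in (s : ℝ)..τ, f r (u (Set.projIcc 0 τ hτ r))
  continuous_toFun := by
    have hi := hf.integrableOn (continuous_extend hτ u).continuousOn
    have hc := intervalIntegral.continuousOn_primitive_interval_left (a := 0) (b := τ)
      (f := fun r => f r (u (Set.projIcc 0 τ hτ r))) (μ := volume)
      (by rwa [Set.uIcc_of_le hτ])
    rw [Set.uIcc_of_le hτ] at hc
    exact continuous_const.add (continuousOn_iff_continuous_domRestrict.1 hc)

lemma integral_pow_sub (s τ : ℝ) (k : ℕ) :
    ∫ r in s..τ, (τ - r) ^ k = (τ - s) ^ (k + 1) / (k + 1) := by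
  rw [intervalIntegral.integral_comp_sub_left (fun r => r ^ k), integral_pow]
  simp

lemma dist_picardMap_iterate_le (hf : IsLipschitzRHS f τ μ) (hτ : 0 ≤ τ) (hμ : 0 ≤ μ) (y : E)
    (u v : C(Set.Icc 0 τ, E)) (k : ℕ) (s : Set.Icc 0 τ) :
    dist ((picardMap hf hτ y)^[k] u s) ((picardMap hf hτ y)^[k] v s) ≤
      (μ * (τ - s)) ^ k / k.factorial * dist u v := by
  induction k generalizing s with
  | zero => simpa using ContinuousMap.dist_apply_le_dist s
  | succ k ih =>
    rw [Function.iterate_succ_apply', Function.iterate_succ_apply']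
    set u' := (picardMap hf hτ y)^[k] u
    set v' := (picardMap hf hτ y)^[k] v
    have hiu := hf.intervalIntegrable hτ (continuous_extend hτ u').continuousOn s.2
    have hiv := hf.intervalIntegrable hτ (continuous_extend hτ v').continuousOn s.2
    have heq : picardMap hf hτ y u' s - picardMap hf hτ y v' s =
        ∫ r in (s : ℝ)..τ, (f r (u' (Set.projIcc 0 τ hτ r)) - f r (v' (Set.projIcc 0 τ hτ r))) := by
      rw [intervalIntegral.integral_sub hiu hiv]
      simp [picardMap]
    rw [dist_eq_norm, heq]
    have hbound : ∀ᵐ r, r ∈ Set.Ioc (s : ℝ) τ →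
        ‖f r (u' (Set.projIcc 0 τ hτ r)) - f r (v' (Set.projIcc 0 τ hτ r))‖ ≤
          μ ^ (k + 1) / k.factorial * dist u v * (τ - r) ^ k := by
      have hlip := (ae_restrict_iff' measurableSet_Icc).1 hf.lipschitz
      filter_upwards [hlip] with r hr hrs
      have hr' : r ∈ Set.Icc 0 τ := ⟨s.2.1.trans hrs.1.le, hrs.2⟩
      refine (hr hr' _ _).trans ?_
      rw [← dist_eq_norm, Set.projIcc_of_mem hτ hr']
      refine (mul_le_mul_of_nonneg_left (ih ⟨r, hr'⟩) hμ).trans (le_of_eq ?_)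
      rw [mul_pow]
      ring
    refine (intervalIntegral.norm_integral_le_of_norm_le s.2.2 hbound
      (Continuous.intervalIntegrable (by fun_prop) _ _)).trans (le_of_eq ?_)
    rw [intervalIntegral.integral_const_mul, integral_pow_sub, Nat.factorial_succ, mul_pow]
    push_cast
    field_simp

variable [CompleteSpace E]

/-- Existence of solutions: some iterate of the Picard operator is a contraction. -/
lemma IsLipschitzRHS.exists_solution (hf : IsLipschitzRHS f τ μ) (hτ : 0 ≤ τ) (hμ : 0 ≤ μ)
    (y : E) : ∃ φ : ℝ → E, ContinuousOn φ (Set.Icc 0 τ) ∧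
      ∀ s ∈ Set.Icc 0 τ, φ s = y + ∫ r in s..τ, f r (φ r) := by
  obtain ⟨k, hk⟩ := ((FloorSemiring.tendsto_pow_div_factorial_atTop (μ * τ)).eventually
    (gt_mem_nhds one_pos)).exists
  have hnn : 0 ≤ (μ * τ) ^ k / k.factorial := by positivity
  have hcontr : ContractingWith ⟨(μ * τ) ^ k / k.factorial, hnn⟩ (picardMap hf hτ y)^[k] := by
    refine ⟨by exact_mod_cast hk, LipschitzWith.of_dist_le_mul fun u v => ?_⟩
    refine (ContinuousMap.dist_le (by positivity)).2 fun s => ?_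
    refine (dist_picardMap_iterate_le hf hτ hμ y u v k s).trans ?_
    have hs : (0 : ℝ) ≤ τ - s := sub_nonneg.2 s.2.2
    have hs' : τ - (s : ℝ) ≤ τ := sub_le_self _ s.2.1
    refine mul_le_mul_of_nonneg_right ?_ dist_nonneg
    change (μ * (τ - s)) ^ k / k.factorial ≤ (μ * τ) ^ k / k.factorial
    gcongr
  have hfix := hcontr.isFixedPt_fixedPoint_iterate
  set u := ContractingWith.fixedPoint _ hcontr
  refine ⟨fun r => u (Set.projIcc 0 τ hτ r), (continuous_extend hτ u).continuousOn,
    fun s hs => ?_⟩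
  dsimp only
  rw [Set.projIcc_of_mem hτ hs]
  exact (DFunLike.congr_fun hfix ⟨s, hs⟩).symm

end BackwardODE

/-! ### The explicit solution -/

section Explicit

variable {n d : ℕ} {T τ : ℝ≥0} {μ : ℝ} {g : ℝ → Vec n → Mat n d → Vec n} {h : ℝ → Mat n d}
  {y : Vec n} {φ : ℝ → Vec n}

lemma IsDetGenerator.aestronglyMeasurable (hg : IsDetGenerator T μ g) (hτ : τ ≤ T)
    (hh : Measurable fun s : Set.Icc (0 : ℝ) τ => h s) (hφ : ContinuousOn φ (Set.Icc 0 τ)) :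
    AEStronglyMeasurable (fun r => g r (φ r) (h r)) (volume.restrict (Set.Icc (0 : ℝ) τ)) := by
  refine (aemeasurable_restrict_Icc ?_).aestronglyMeasurable
  have hsub : Set.Icc (0 : ℝ) τ ⊆ Set.Icc (0 : ℝ) T :=
    Set.Icc_subset_Icc_right (by exact_mod_cast hτ)
  have hmap : Measurable fun s : Set.Icc (0 : ℝ) τ =>
      ((⟨s, hsub s.2⟩ : Set.Icc (0 : ℝ) T), φ s, h s) :=
    (measurable_subtype_coe.subtype_mk).prodMk
      ((continuousOn_iff_continuous_domRestrict.1 hφ).measurable.prodMk hh)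
  exact hg.measurable.comp hmap

lemma IsDetGenerator.integrableOn_zero_of_sq (hg : IsDetGenerator T μ g) (hτ : τ ≤ T)
    (hh : Measurable fun s : Set.Icc (0 : ℝ) τ => h s)
    (hi : IntegrableOn (fun s => ‖g s 0 (h s)‖ ^ 2) (Set.Icc (0 : ℝ) τ)) :
    IntegrableOn (fun s => g s 0 (h s)) (Set.Icc (0 : ℝ) τ) := by
  have hm := hg.aestronglyMeasurable hτ hh (φ := fun _ => 0) continuousOn_const
  exact ((memLp_two_iff_integrable_sq_norm hm).2 hi).integrable (by norm_num)

lemma IsDetGenerator.isLipschitzRHS (hg : IsDetGenerator T μ g) (hτ : τ ≤ T)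
    (hh : Measurable fun s : Set.Icc (0 : ℝ) τ => h s)
    (hi : IntegrableOn (fun r => g r 0 (h r)) (Set.Icc (0 : ℝ) τ)) :
    IsLipschitzRHS (fun r x => g r x (h r)) τ μ where
  measurable _ hφ := hg.aestronglyMeasurable hτ hh hφ
  integrable_zero := hi
  lipschitz := by
    have := ae_mono (Measure.restrict_mono (Set.Icc_subset_Icc_right
      (by exact_mod_cast hτ : (τ : ℝ) ≤ T)) le_rfl) hg.lipschitz
    filter_upwards [this] with r hr x x'
    exact hr x x' (h r)

lemma memDetL2_of_continuousOn {E : Type*} [NormedAddCommGroup E] [MeasurableSpace E]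
    [BorelSpace E] {φ : ℝ → E} (hφ : ContinuousOn φ (Set.Icc 0 τ)) : MemDetL2 τ φ where
  measurable := (continuousOn_iff_continuous_domRestrict.1 hφ).measurable
  sq_integrable := by
    have := ((hφ.norm.pow 2).integrableOn_compact isCompact_Icc (μ := volume)).2
    simpa [HasFiniteIntegral, enorm_pow] using this

lemma IsDetGenerator.exists_isBackwardODESolution (hg : IsDetGenerator T μ g) (hμ : 0 ≤ μ)
    (hτ : τ ≤ T) (hh : Measurable fun s : Set.Icc (0 : ℝ) τ => h s)
    (hi : IntegrableOn (fun r => g r 0 (h r)) (Set.Icc (0 : ℝ) τ)) (y : Vec n) :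
    ∃ φ, IsBackwardODESolution g y h τ φ := by
  have hf := hg.isLipschitzRHS hτ hh hi
  obtain ⟨φ, hφ, heq⟩ := hf.exists_solution τ.coe_nonneg hμ y
  exact ⟨φ, memDetL2_of_continuousOn hφ,
    hf.intervalIntegrable τ.coe_nonneg hφ (Set.left_mem_Icc.2 τ.coe_nonneg), heq⟩

lemma IsBackwardODESolution.continuousOn (hφ : IsBackwardODESolution g y h τ φ) :
    ContinuousOn φ (Set.Icc 0 τ) := by
  have hi := (intervalIntegrable_iff_integrableOn_Icc_of_le τ.coe_nonneg).1 hφ.integrable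
  have hc := intervalIntegral.continuousOn_primitive_interval_left (a := 0) (b := (τ : ℝ))
    (f := fun r => g r (φ r) (h r)) (μ := volume) (by rwa [Set.uIcc_of_le τ.coe_nonneg])
  rw [Set.uIcc_of_le τ.coe_nonneg] at hc
  exact (continuousOn_const.add hc).congr hφ.eqn

variable {Ω : Type*} [mΩ : MeasurableSpace Ω] {F : Filtration ℝ≥0 mΩ} {P : Measure Ω}
  [IsProbabilityMeasure P] {B : ℝ≥0 → Ω → Vec d} {M : ℝ≥0 → Ω → Vec n}

/-- Adding the Itô integral of `h` to a solution of the backward equation gives a solution of the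
mean-field BSDE, because the Itô integral is centred. -/
lemma IsBackwardODESolution.isMeanFieldBSDESolution
    (hB : ∀ j, IsFilteredBrownian (fun t ω => B t ω j) F P) (hh : MemDetL2 τ h)
    (hφ : IsBackwardODESolution g y h τ φ) (hM : IsItoIntegral P F B τ (fun s _ => h s) M) :
    IsMeanFieldBSDESolution P F B g y h τ (fun s ω => φ s + M s ω) (fun s _ => h s) := by
  have hMs : ∀ s ≤ τ, Integrable (M s) P ∧ ∫ ω, M s ω ∂P = 0 := fun s hs =>
    ⟨(hM.memLp_and_integral_eq_zero hB hh hs).1.integrable (by norm_num),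
      (hM.memLp_and_integral_eq_zero hB hh hs).2⟩
  have hgen : ∀ r ∈ Set.Icc (0 : ℝ) τ,
      g r (∫ ω, (φ r.toNNReal + M r.toNNReal ω) ∂P) (h r.toNNReal) = g r (φ r) (h r) := by
    intro r hr
    obtain ⟨h1, h2⟩ := hMs r.toNNReal (Real.toNNReal_le_iff_le_coe.2 hr.2)
    rw [integral_add (integrable_const _) h1, h2]
    simp [Real.coe_toNNReal r hr.1]
  refine ⟨⟨?_, ?_⟩, memH2_of_memDetL2 hh, fun s hs => (integrable_const _).add (hMs s hs).1, ?_,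
    M, M, hM, hM, ?_⟩
  · exact (isPredictableUpTo_of_measurable_Icc hφ.mem.measurable).add hM.integral_mem.predictable
  · filter_upwards [hM.integral_mem.continuous] with ω hω
    refine ContinuousOn.add ?_ hω
    exact hφ.continuousOn.comp NNReal.continuous_coe.continuousOn fun s hs =>
      ⟨s.2, by exact_mod_cast hs⟩
  · refine ae_of_all _ fun ω => ?_
    refine (intervalIntegrable_congr fun r hr => ?_).2 hφ.integrable
    rw [Set.uIoc_of_le τ.coe_nonneg] at hr
    exact hgen r (Set.Ioc_subset_Icc_self hr)
  · refine ae_of_all _ fun ω s hs => ?_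
    have hs' : (s : ℝ) ≤ τ := by exact_mod_cast hs
    have hint : ∫ r in (s : ℝ)..τ, g r (∫ ω, (φ r.toNNReal + M r.toNNReal ω) ∂P) (h r.toNNReal) =
        ∫ r in (s : ℝ)..τ, g r (φ r) (h r) := by
      refine intervalIntegral.integral_congr fun r hr => ?_
      rw [Set.uIcc_of_le hs'] at hr
      exact hgen r ⟨s.2.trans hr.1, hr.2⟩
    rw [hint, hφ.eqn s ⟨s.2, hs'⟩]
    abel

end Explicit

/-! ### The representation of the generator -/

section Representation

variable {n d : ℕ} {T : ℝ≥0} {μ : ℝ} {g : ℝ → Vec n → Mat n d → Vec n} {t ε : ℝ≥0}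
  {y : Vec n} {z : Mat n d} {φ : ℝ → Vec n}

lemma memDetL2_constOn (τ t ε : ℝ≥0) (z : Mat n d) : MemDetL2 τ (constOn t ε z) where
  measurable := (measurable_const.indicator measurableSet_Icc).comp measurable_subtype_coe
  sq_integrable := by
    refine lt_of_le_of_lt (lintegral_mono (g := fun _ => ‖z‖ₑ ^ 2) fun r => ?_) ?_
    · exact pow_le_pow_left' (enorm_indicator_le_enorm_self (fun _ => z) r) 2
    · rw [lintegral_const, Measure.restrict_apply_univ]
      exact ENNReal.mul_lt_top (ENNReal.pow_lt_top enorm_lt_top) measure_Icc_lt_top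

lemma IsDetGenerator.integrableOn_zero_constOn (hg : IsDetGenerator T μ g) {τ : ℝ≥0} (hτ : τ ≤ T)
    (t ε : ℝ≥0) (z : Mat n d) :
    IntegrableOn (fun r => g r 0 (constOn t ε z r)) (Set.Icc (0 : ℝ) τ) := by
  have hsub : Set.Icc (0 : ℝ) τ ⊆ Set.Icc (0 : ℝ) T :=
    Set.Icc_subset_Icc_right (by exact_mod_cast hτ)
  have hm := hg.aestronglyMeasurable hτ (memDetL2_constOn τ t ε z).measurable
    (φ := fun _ => 0) continuousOn_const
  refine (((hg.integrable 0 z).mono_set hsub).norm.add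
    ((hg.integrable 0 0).mono_set hsub).norm).mono' hm (ae_of_all _ fun r => ?_)
  simp only [Pi.add_apply]
  by_cases hr : r ∈ Set.Icc (t : ℝ) (t + ε)
  · rw [constOn, Set.indicator_of_mem hr]
    linarith [norm_nonneg (g r 0 0)]
  · rw [constOn, Set.indicator_of_notMem hr]
    linarith [norm_nonneg (g r 0 z)]

/-- Over a short interval `[t, t + ε]`, the increment of the solution of the backward equation is
close to the integral of `g(·, y, z)`. The error is `o(ε)`, since the integral on the right-hand
side tends to zero with `ε`. -/
lemma IsBackwardODESolution.norm_sub_integral_le (hg : IsDetGenerator T μ g) (hμ : 0 < μ)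
    (hT : t + ε ≤ T) (hμε : μ * ε ≤ 1 / 2)
    (hφ : IsBackwardODESolution g y (constOn t ε z) (t + ε) φ) :
    ‖(φ t - y) - ∫ r in (t : ℝ)..t + ε, g r y z‖ ≤
      ε * (2 * μ * ∫ r in (t : ℝ)..t + ε, ‖g r y z‖) := by
  have hle : (t : ℝ) ≤ t + ε := by simp
  have hTr : (t : ℝ) + ε ≤ T := by exact_mod_cast hT
  have hsub : Set.Icc (t : ℝ) (t + ε) ⊆ Set.Icc (0 : ℝ) T := Set.Icc_subset_Icc t.coe_nonneg hTr
  set A : ℝ := ∫ r in (t : ℝ)..t + ε, ‖g r y z‖ with hA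
  have hgi : IntervalIntegrable (fun r => g r y z) volume t (t + ε) := by
    rw [intervalIntegrable_iff_integrableOn_Icc_of_le hle]
    exact (hg.integrable y z).mono_set hsub
  have hφc : ContinuousOn φ (Set.Icc (t : ℝ) (t + ε)) :=
    hφ.continuousOn.mono (by push_cast; exact Set.Icc_subset_Icc_left t.coe_nonneg)
  have hφi : IntervalIntegrable (fun r => g r (φ r) z) volume t (t + ε) := by
    have h1 : IntervalIntegrable (fun r => g r (φ r) (constOn t ε z r)) volume t (t + ε) := by
      refine hφ.integrable.mono_set ?_
      push_cast
      rw [Set.uIcc_of_le hle, Set.uIcc_of_le (t.coe_nonneg.trans hle)]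
      exact Set.Icc_subset_Icc_left t.coe_nonneg
    refine (intervalIntegrable_congr fun r hr => ?_).1 h1
    rw [Set.uIoc_of_le hle] at hr
    simp only [constOn, Set.indicator_of_mem (Set.Ioc_subset_Icc_self hr)]
  have heqn : ∀ s ∈ Set.Icc (t : ℝ) (t + ε), φ s - y = ∫ r in s..t + ε, g r (φ r) z := by
    intro s hs
    rw [hφ.eqn s ⟨t.coe_nonneg.trans hs.1, by push_cast; exact hs.2⟩, add_sub_cancel_left]
    push_cast
    refine intervalIntegral.integral_congr fun r hr => ?_
    rw [Set.uIcc_of_le hs.2] at hr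
    have hr' : r ∈ Set.Icc (t : ℝ) (t + ε) := ⟨hs.1.trans hr.1, hr.2⟩
    simp only [constOn, Set.indicator_of_mem hr']
  have hlip : ∀ᵐ r, r ∈ Set.Icc (t : ℝ) (t + ε) → ‖g r (φ r) z - g r y z‖ ≤ μ * ‖φ r - y‖ := by
    have := (ae_restrict_iff' measurableSet_Icc).1 hg.lipschitz
    filter_upwards [this] with r hr hrs
    exact hr (hsub hrs) _ _ _
  -- the maximal deviation `m` of `φ` from `y` satisfies `m ≤ A + μ ε m`
  obtain ⟨s₀, hs₀, hmax⟩ := isCompact_Icc.exists_isMaxOn (Set.nonempty_Icc.2 hle)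
    (hφc.sub continuousOn_const).norm (f := fun r => ‖φ r - y‖)
  obtain ⟨m, hm⟩ : ∃ m, m = ‖φ s₀ - y‖ := ⟨_, rfl⟩
  have hm0 : 0 ≤ m := hm ▸ norm_nonneg _
  have hmax' : ∀ r ∈ Set.Icc (t : ℝ) (t + ε), ‖φ r - y‖ ≤ m := fun r hr => hm ▸ hmax hr
  have hbound : m ≤ 2 * A := by
    have h1 : m ≤ ∫ r in s₀..t + ε, (‖g r y z‖ + μ * m) := by
      refine (hm.trans (congrArg norm (heqn s₀ hs₀))).le.trans ?_
      refine intervalIntegral.norm_integral_le_of_norm_le hs₀.2 ?_ ?_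
      · filter_upwards [hlip] with r hr hrs
        have hr' : r ∈ Set.Icc (t : ℝ) (t + ε) := ⟨hs₀.1.trans hrs.1.le, hrs.2⟩
        have h2 := norm_add_le (g r y z) (g r (φ r) z - g r y z)
        rw [add_sub_cancel] at h2
        refine h2.trans (add_le_add le_rfl ((hr hr').trans ?_))
        exact mul_le_mul_of_nonneg_left (hmax' r hr') hμ.le
      · refine (IntervalIntegrable.add hgi.norm intervalIntegrable_const).mono_set ?_
        rw [Set.uIcc_of_le hs₀.2, Set.uIcc_of_le hle]
        exact Set.Icc_subset_Icc_left hs₀.1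
    have h2 : ∫ r in s₀..t + ε, (‖g r y z‖ + μ * m) ≤
        ∫ r in (t : ℝ)..t + ε, (‖g r y z‖ + μ * m) := by
      refine intervalIntegral.integral_mono_interval hs₀.1 hs₀.2 le_rfl
        (ae_of_all _ fun r => ?_) (hgi.norm.add intervalIntegrable_const)
      exact add_nonneg (norm_nonneg _) (mul_nonneg hμ.le hm0)
    rw [intervalIntegral.integral_add hgi.norm intervalIntegrable_const,
      intervalIntegral.integral_const, add_sub_cancel_left, smul_eq_mul] at h2
    have h3 : (ε : ℝ) * (μ * m) ≤ 1 / 2 * m := by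
      rw [← mul_assoc, mul_comm (ε : ℝ)]
      exact mul_le_mul_of_nonneg_right hμε hm0
    linarith
  rw [heqn t (Set.left_mem_Icc.2 hle), ← intervalIntegral.integral_sub hφi hgi]
  have hfin : ‖∫ r in (t : ℝ)..t + ε, (g r (φ r) z - g r y z)‖ ≤
      ∫ _ in (t : ℝ)..t + ε, μ * (2 * A) := by
    refine intervalIntegral.norm_integral_le_of_norm_le hle ?_ intervalIntegrable_const
    filter_upwards [hlip] with r hr hrs
    have hr' := Set.Ioc_subset_Icc_self hrs
    exact (hr hr').trans (mul_le_mul_of_nonneg_left ((hmax' r hr').trans hbound) hμ.le)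
  refine hfin.trans (le_of_eq ?_)
  rw [intervalIntegral.integral_const, add_sub_cancel_left, smul_eq_mul]
  ring

/-- At almost every time `t`, the difference quotients of the solutions of the backward equations
on `[0, t + ε]` converge to the generator. -/
lemma IsDetGenerator.ae_tendsto_backwardODE (hg : IsDetGenerator T μ g) (hμ : 0 < μ) (y : Vec n)
    (z : Mat n d) :
    ∀ᵐ x ∂(volume.restrict (Set.Ico (0 : ℝ) T)), ∀ t : ℝ≥0, (t : ℝ) = x →
      ∀ φ : ℝ≥0 → ℝ → Vec n, (∀ ε, 0 < ε → t + ε ≤ T →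
        IsBackwardODESolution g y (constOn t ε z) (t + ε) (φ ε)) →
      Tendsto (fun ε : ℝ≥0 => (ε : ℝ)⁻¹ • (φ ε t - y)) (𝓝[>] 0) (𝓝 (g t y z)) := by
  set G : ℝ → Vec n := (Set.Icc (0 : ℝ) T).indicator fun r => g r y z with hG
  have hGi : Integrable G := (integrable_indicator_iff measurableSet_Icc).2 (hg.integrable y z)
  rw [ae_restrict_iff' measurableSet_Ico]
  filter_upwards [LocallyIntegrable.ae_hasDerivAt_integral hGi.locallyIntegrable] with x hx hxT
  rintro t rfl φ hφ
  have htT : t < T := by exact_mod_cast hxT.2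
  have hcoe : Tendsto (fun ε : ℝ≥0 => (ε : ℝ)) (𝓝[>] 0) (𝓝[≠] 0) := by
    refine tendsto_nhdsWithin_iff.2 ⟨?_, ?_⟩
    · exact (NNReal.continuous_coe.tendsto' 0 0 rfl).mono_left nhdsWithin_le_nhds
    · filter_upwards [self_mem_nhdsWithin] with ε hε
      exact (NNReal.coe_pos.2 hε).ne'
  have hcoe0 : Tendsto (fun ε : ℝ≥0 => (ε : ℝ)) (𝓝[>] 0) (𝓝 0) :=
    hcoe.mono_right nhdsWithin_le_nhds
  have hmain : Tendsto (fun ε : ℝ≥0 => (ε : ℝ)⁻¹ • ∫ r in (t : ℝ)..t + ε, G r) (𝓝[>] 0)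
      (𝓝 (g t y z)) := by
    have h1 := (hasDerivAt_iff_tendsto_slope_zero.1 (hx t)).comp hcoe
    have h2 : G t = g t y z := Set.indicator_of_mem (Set.Ico_subset_Icc_self hxT) _
    rw [h2] at h1
    simpa [Function.comp_def] using h1
  have hA : Tendsto (fun ε : ℝ≥0 => ∫ r in (t : ℝ)..t + ε, ‖G r‖) (𝓝[>] 0) (𝓝 0) := by
    have hc : Continuous fun b : ℝ => ∫ r in (t : ℝ)..b, ‖G r‖ :=
      intervalIntegral.continuous_primitive (fun a b => hGi.norm.intervalIntegrable) _
    have h1 := ((hc.comp (continuous_const_add (t : ℝ))).tendsto 0).comp hcoe0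
    simpa [Function.comp_def] using h1
  have herr : Tendsto (fun ε : ℝ≥0 => (ε : ℝ)⁻¹ • (φ ε t - y) -
      (ε : ℝ)⁻¹ • ∫ r in (t : ℝ)..t + ε, G r) (𝓝[>] 0) (𝓝 0) := by
    refine squeeze_zero_norm' ?_ (by simpa using hA.const_mul (2 * μ))
    have hev1 : ∀ᶠ ε : ℝ≥0 in 𝓝[>] 0, t + ε ≤ T := by
      have : ∀ᶠ ε : ℝ≥0 in 𝓝 0, t + ε < T :=
        ((continuous_const.add continuous_id).tendsto (0 : ℝ≥0)).eventually
          (gt_mem_nhds (by simpa using htT))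
      exact (this.filter_mono nhdsWithin_le_nhds).mono fun _ h => h.le
    have hev2 : ∀ᶠ ε : ℝ≥0 in 𝓝[>] 0, μ * ε ≤ 1 / 2 := by
      have h1 : Tendsto (fun ε : ℝ≥0 => μ * (ε : ℝ)) (𝓝[>] 0) (𝓝 0) := by
        simpa using hcoe0.const_mul μ
      exact h1.eventually (ge_mem_nhds (by norm_num : (0 : ℝ) < 1 / 2))
    filter_upwards [hev1, hev2, self_mem_nhdsWithin] with ε h1 h2 h3
    have hε : (0 : ℝ) < ε := NNReal.coe_pos.2 h3
    have hGg : ∀ r ∈ Set.uIcc (t : ℝ) (t + ε), G r = g r y z := by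
      intro r hr
      rw [Set.uIcc_of_le (by simp)] at hr
      have hr' : r ∈ Set.Icc (0 : ℝ) T :=
        ⟨t.coe_nonneg.trans hr.1, hr.2.trans (by exact_mod_cast h1)⟩
      exact Set.indicator_of_mem hr' _
    have hb := (hφ ε h3 h1).norm_sub_integral_le hg hμ h1 h2
    rw [intervalIntegral.integral_congr hGg,
      intervalIntegral.integral_congr (g := fun r => ‖g r y z‖) fun r hr => by
        simp only [hGg r hr], ← smul_sub, norm_smul, norm_inv, Real.norm_of_nonneg hε.le,
      inv_mul_le_iff₀ hε]
    exact hb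
  simpa using herr.add hmain

end Representation

end MeanFieldBSDE

theorem proposition2p8 {Ω : Type*} [MeasurableSpace Ω] (P : Measure Ω) [IsProbabilityMeasure P]
    [P.IsComplete] {n d : ℕ} (B : ℝ≥0 → Ω → Vec d)
    (hB : IsBrownianMotion B P) (T : ℝ≥0) (hT : 0 < T) (μ : ℝ) (hμ : 0 < μ)
    (g : ℝ → Vec n → Mat n d → Vec n)
    (hg : IsDetGenerator T μ g) :
    -- the explicit solution, for a general square integrable deterministic `h`
    (∀ (t ε : ℝ≥0) (y : Vec n) (h : ℝ → Mat n d),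
      t < T → t + ε ≤ T → MemDetL2 (t + ε) h →
      IntegrableOn (fun s => ‖g s 0 (h s)‖ ^ 2) (Set.Icc (0 : ℝ) (t + ε)) →
      (∃ φ, IsBackwardODESolution g y h (t + ε) φ) ∧
      (∃ M, IsItoIntegral P (augmentedFiltration hB) B (t + ε)
        (fun s _ => h s) M) ∧
      ∀ φ M, IsBackwardODESolution g y h (t + ε) φ →
        IsItoIntegral P (augmentedFiltration hB) B (t + ε)
          (fun s _ => h s) M →
        IsMeanFieldBSDESolution P (augmentedFiltration hB) B
          g y h (t + ε) (fun s ω => φ s + M s ω) (fun s _ => h s)) ∧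
    -- the same for `h = z 1_{[t, t+ε]}`, with no further condition on the generator
    (∀ (t ε : ℝ≥0) (y : Vec n) (z : Mat n d),
      t < T → t + ε ≤ T →
      (∃ φ, IsBackwardODESolution g y (constOn t ε z) (t + ε) φ) ∧
      (∃ M, IsItoIntegral P (augmentedFiltration hB) B (t + ε)
        (fun s _ => constOn t ε z s) M) ∧
      ∀ φ M, IsBackwardODESolution g y (constOn t ε z) (t + ε) φ →
        IsItoIntegral P (augmentedFiltration hB) B (t + ε)
          (fun s _ => constOn t ε z s) M →
        IsMeanFieldBSDESolution P (augmentedFiltration hB) B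
          g y (constOn t ε z) (t + ε) (fun s ω => φ s + M s ω)
          (fun s _ => constOn t ε z s)) ∧
    -- the invariant representation, where `Y ε` is the explicit solution on `[0, t + ε]`
    (∀ (y : Vec n) (z : Mat n d),
      ∀ᵐ x ∂(volume.restrict (Set.Ico (0 : ℝ) T)), ∀ t : ℝ≥0, (t : ℝ) = x →
      ∀ (φ : ℝ≥0 → ℝ → Vec n) (M Y : ℝ≥0 → ℝ≥0 → Ω → Vec n),
      (∀ ε, 0 < ε → t + ε ≤ T →
        IsBackwardODESolution g y (constOn t ε z) (t + ε) (φ ε) ∧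
        IsItoIntegral P (augmentedFiltration hB) B (t + ε)
          (fun s _ => constOn t ε z s) (M ε) ∧
        ∀ s ≤ t + ε, ∀ᵐ ω ∂P, Y ε s ω = φ ε s + M ε s ω) →
      -- each `Y ε t` is almost surely equal to a constant `c ε`, and these constants converge
      ∃ c : ℝ≥0 → Vec n,
        (∀ ε, 0 < ε → t + ε ≤ T → ∀ᵐ ω ∂P, Y ε t ω = c ε) ∧
        Tendsto (fun ε : ℝ≥0 => (ε : ℝ)⁻¹ • (c ε - y)) (𝓝[>] 0) (𝓝 (g t y z))) := by
  have hBF := fun j => hB.isFilteredBrownian j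
  have hnull : ∀ N, P N = 0 → MeasurableSet[augmentedFiltration hB 0] N := fun N hN =>
    (le_sup_right : MeasurableSpace.generateFrom {N : Set Ω | P N = 0} ≤ _) N
      (MeasurableSpace.measurableSet_generateFrom hN)
  have hcont : ∀ᵐ ω ∂P, ∀ j, Continuous fun t => B t ω j :=
    ae_all_iff.2 fun j => (hB.component j).cont
  refine ⟨fun t ε y h _ hT' hh hi => ?_, fun t ε y z _ hT' => ?_, fun y z => ?_⟩
  · exact ⟨hg.exists_isBackwardODESolution hμ.le hT' hh.measurable
        (hg.integrableOn_zero_of_sq hT' hh.measurable hi) y,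
      exists_isItoIntegral hnull hBF hcont hh,
      fun φ M hφ hM => hφ.isMeanFieldBSDESolution hBF hh hM⟩
  · have hh := memDetL2_constOn (t + ε) t ε z
    exact ⟨hg.exists_isBackwardODESolution hμ.le hT' hh.measurable
        (hg.integrableOn_zero_constOn hT' t ε z) y,
      exists_isItoIntegral hnull hBF hcont hh,
      fun φ M hφ hM => hφ.isMeanFieldBSDESolution hBF hh hM⟩
  · filter_upwards [hg.ae_tendsto_backwardODE hμ y z] with x hx t htx φ M Y hY
    refine ⟨fun ε => φ ε t, fun ε hε hT' => ?_, hx t htx φ fun ε hε hT' => (hY ε hε hT').1⟩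
    obtain ⟨-, hM, hYM⟩ := hY ε hε hT'
    have hle : t ≤ t + ε := le_self_add
    -- the integrand vanishes before time `t`, so the Itô integral does too
    have hM0 := hM.ae_eq_zero hBF hle fun r hr =>
      Set.indicator_of_notMem (fun h => absurd h.1 (not_le.2 hr.2)) _
    filter_upwards [hYM t hle, hM0] with ω h1 h2
    rw [h1, h2, Pi.zero_apply, add_zero]
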